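/- Let $F$ be a non-archimedean local field with ring of integers $\mathcal{O}_F$ and residue field of order $q$. Give $PGL(2,F)=GL(2,F)/F^\times$ the quotient topology and regard $PGL(2,\mathcal{O}_F)$ as the image of $GL(2,\mathcal{O}_F)$ in $PGL(2,F)$. Let $\Gamma$ be a lattice in $G=PGL(2,F)$, that is, a discrete subgroup such that $G/\Gamma$ carries a finite nonzero $G$-invariant Radon measure, and suppose that $\Gamma$ is isomorphic to the free group $F_n$ on $n$ generators, $n$ a natural number. For a Haar measure $\mu$ on $G$, the volume of $G/\Gamma$ is the total mass of the $G$-invariant Radon measure $\xi$ on $G/\Gamma$ with $$\int_G f(g)\,d\mu(g)=\int_{G/\Gamma}\sum_{\gamma\in\Gamma}f(g\gamma)\,d\xi(g\Gamma)\qquad (f\in C_c(G)).$$ Then the volume of $PGL(2,F)/\Gamma$ is equal to (i) $\dfrac{2(n-1)}{q-1}$ if the Haar measure $\mu$ is normalized so that the volume of $PGL(2,\mathcal{O}_F)$ is $1$; (ii) $\dfrac{2(n-1)(q+1)}{q-1}$ if $\mu$ is normalized so that the volume of $PGL(2,\mathcal{O}_F)$ is $q+1$; (iii) $n-1$ if $\mu$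 is normalized so that the volume of $PGL(2,\mathcal{O}_F)$ is $\frac12(q-1)$. -/

import Mathlib

open MeasureTheory Matrix ValuativeRel
open scoped MatrixGroups ENNReal

/-- The topology of `PGL(n, R)`: the quotient topology from `GL n R`, which itself carries the
topology of the group of units of the matrix ring. -/
instance PGL.instTopologicalSpace (n : Type*) [Fintype n] [DecidableEq n] (R : Type*) [CommRing R]
    [TopologicalSpace R] : TopologicalSpace PGL(n, R) :=
  inferInstanceAs (TopologicalSpace (GL n R ⧸ Subgroup.center (GL n R)))

section Lattice

variable {G : Type*} [Group G] [TopologicalSpace G] [MeasurableSpace G]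

/-- A Haar measure on the coset space `G ⧸ Γ`: a nonzero Radon measure that is invariant under
left translation by `G`. -/
structure IsCosetHaar (Γ : Subgroup G) (ξ : Measure (G ⧸ Γ)) : Prop where
  regular : ξ.Regular
  invariant : SMulInvariantMeasure G (G ⧸ Γ) ξ
  ne_zero : ξ ≠ 0

/-- A lattice: a discrete subgroup `Γ` such that `G ⧸ Γ` supports a finite Haar measure. -/
def IsGroupLattice (Γ : Subgroup G) : Prop :=
  DiscreteTopology Γ ∧ ∃ ξ : Measure (G ⧸ Γ), IsCosetHaar Γ ξ ∧ IsFiniteMeasure ξ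

/-- The Haar measure `ξ` on `G ⧸ Γ` is normalized compatibly with the Haar measure `μ` on `G`:
`∫_G f(g) dμ(g) = ∫_{G ⧸ Γ} ∑_{γ ∈ Γ} f(g γ) dξ(g Γ)` for all `f ∈ C_c(G)`. The function
`QuotientGroup.automorphize f` is `g Γ ↦ ∑_{γ ∈ Γ} f(g γ)`. -/
def IsCompatibleCosetHaar (μ : Measure G) (Γ : Subgroup G) (ξ : Measure (G ⧸ Γ)) : Prop :=
  IsCosetHaar Γ ξ ∧
    ∀ f : G → ℝ, Continuous f → HasCompactSupport f →
      ∫ g, f g ∂μ = ∫ x, (QuotientGroup.automorphize f : G ⧸ Γ → ℝ) x ∂ξ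

/-- The volume of `G ⧸ Γ`, with respect to the Haar measure `μ` on `G`, is `v`: a Haar measure on
`G ⧸ Γ` compatible with `μ` exists, and every such measure has total mass `v`. -/
def HasCovolume (μ : Measure G) (Γ : Subgroup G) (v : ℝ≥0∞) : Prop :=
  (∃ ξ : Measure (G ⧸ Γ), IsCompatibleCosetHaar μ Γ ξ) ∧
    ∀ ξ : Measure (G ⧸ Γ), IsCompatibleCosetHaar μ Γ ξ → ξ Set.univ = v

end Lattice

/-- `PGL(2, 𝒪_F)` as a subgroup of `PGL(2, F)`: the image of `GL(2, 𝒪_F)`. -/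
noncomputable def integralPGL (F : Type*) [Field F] [ValuativeRel F] : Subgroup PGL(2, F) :=
  ((ProjGenLinGroup.mk : GL (Fin 2) F →* PGL(2, F)).comp
    (GeneralLinearGroup.map (Subring.subtype (Valuation.integer (valuation F))))).range

/-- The order `q` of the residue field of `F`. -/
noncomputable def residueCard (F : Type*) [Field F] [ValuativeRel F] : ℕ :=
  Nat.card (IsLocalRing.ResidueField (Valuation.integer (valuation F)))

/-!
# Covolumes of free lattices in `PGL(2, F)`

Write `G = PGL(2, F)` and `K = PGL(2, 𝒪)`. The cosets `G ⧸ K` are the vertices of the Bruhat–Tits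
tree of `G`, in which every vertex has `q + 1` neighbours. A discrete free group `Γ` is torsion
free, so it meets the compact point stabilizers trivially and acts freely on the vertices
(`eq_one_of_smul_eq`). The volume of `G ⧸ Γ` can then be computed by cutting it into `K`-orbits:
they are indexed by the `Γ`-orbits on `G ⧸ K`, and since `G` is unimodular all of them have the
measure of `K`. Hence a lattice has a finite number `N` of orbits of vertices, and its covolume is
`N * μ K` (`hasCovolume_card_orbits_mul`).

It remains to find `N`. The quotient of the tree by `Γ` is a graph with `N` vertices,
`N (q + 1) / 2` edges and fundamental group `Γ`, so that its Euler characteristic gives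
`N - N (q + 1) / 2 = 1 - n`, that is `N (q - 1) = 2 (n - 1)`
(`card_orbits_mul_eq_of_free_action_on_tree`). This count is made by linear algebra, without
the quotient graph: functions on the vertices that are `Γ`-invariant up to an additive character of
`Γ` form a space of dimension `N + n`; the coboundary maps it onto the space of `Γ`-invariant
antisymmetric functions of oriented edges, of dimension `N (q + 1) / 2`, with the constants as
kernel. Surjectivity uses that the tree is acyclic in the sense that its first rational cohomology
vanishes, and that a primitive of an invariant function has periods in `Hom(Γ, ℚ)`.

The tree is described through the point at infinity of the projective line: by the Iwasawa
decomposition, the vertices are the closed balls of `F`, and the edges join each ball to the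
next larger one, its parent. Connectedness and acyclicity then follow from two facts: any two balls
have a common ancestor, and the radii along a chain of ancestors are distinct.

Unimodularity of `G` holds because `G` is generated by elements conjugate to their inverses, on
which any homomorphism to the positive reals is trivial (`monoidHom_PGL_eq_one`).
-/

/-! ### Antisymmetric functions -/

section Antisymmetric

/-- The space of rational functions on `E` that change sign under `τ`. -/
def antisymmetricFunctions {E : Type*} (τ : E → E) : Submodule ℚ (E → ℚ) where
  carrier := {φ | ∀ e, φ (τ e) = -φ e}
  zero_mem' := by simp
  add_mem' := by
    intro a b ha hb e
    simp [ha e, hb e, add_comm]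
  smul_mem' := by
    intro c a ha e
    simp [ha e]

lemma two_mul_finrank_antisymmetricFunctions {E : Type*} [Finite E] {τ : E → E}
    (hτ : Function.Involutive τ) (hne : ∀ e, τ e ≠ e) :
    2 * Module.finrank ℚ (antisymmetricFunctions τ) = Nat.card E := by
  classical
  obtain ⟨m, ⟨num⟩⟩ := Finite.exists_equiv_fin E
  have hnum : ∀ e, num e ≠ num (τ e) := fun e h => hne e (num.injective h).symm
  -- a half `S` of `E` containing exactly one of `e` and `τ e`
  let S : Set E := {e | num e < num (τ e)}
  have hS : ∀ e, τ e ∈ S ↔ e ∉ S := by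
    intro e
    have := hnum e
    simp only [S, Set.mem_ofPred_eq, hτ e]
    omega
  let toHalf : antisymmetricFunctions τ ≃ₗ[ℚ] (S → ℚ) :=
    { toFun := fun φ s => φ.1 s
      map_add' := fun _ _ => rfl
      map_smul' := fun _ _ => rfl
      invFun := fun ψ => ⟨fun e => if h : e ∈ S then ψ ⟨e, h⟩ else
          -ψ ⟨τ e, (hS e).2 h⟩, by
        intro e
        by_cases h : e ∈ S
        · have h' : τ e ∉ S := fun h' => (hS e).1 h' h
          simp [h, h', hτ e]
        · have h' : τ e ∈ S := (hS e).2 h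
          simp [h, h']⟩
      left_inv := by
        intro φ
        ext e
        by_cases h : e ∈ S
        · simp [h]
        · simp [h, φ.2 e]
      right_inv := by
        intro ψ
        ext s
        simp [s.2] }
  have hcard : Nat.card (S : Set E) = Nat.card (Sᶜ : Set E) := by
    refine Nat.card_congr
      { toFun := fun s => ⟨τ s, fun h => (hS s).1 h s.2⟩
        invFun := fun s => ⟨τ s, (hS s).2 s.2⟩
        left_inv := fun s => Subtype.ext (hτ s)
        right_inv := fun s => Subtype.ext (hτ s) }
  have hfr : Module.finrank ℚ (antisymmetricFunctions τ) = Nat.card S := by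
    have := Fintype.ofFinite S
    rw [toHalf.finrank_eq, Module.finrank_fintype_fun_eq_card, Nat.card_eq_fintype_card]
  have hsum : Nat.card S + Nat.card (Sᶜ : Set E) = Nat.card E := by
    rw [← Nat.card_sum]
    exact Nat.card_congr (Equiv.Set.sumCompl S)
  omega

end Antisymmetric

/-! ### Free group actions on acyclic regular graphs -/

section FreeQuotient

/-- Every antisymmetric rational function on the oriented edges of the graph is the coboundary of
a function on the vertices; that is, the first rational cohomology of the graph vanishes. -/
def SimpleGraph.IsCohomologicallyAcyclic {V : Type*} (T : SimpleGraph V) : Prop :=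
  ∀ φ : V → V → ℚ, (∀ v w, φ w v = -φ v w) → ∃ F : V → ℚ, ∀ v w, T.Adj v w → F w - F v = φ v w

lemma SimpleGraph.Preconnected.eq_of_forall_adj {V α : Type*} {T : SimpleGraph V}
    (hT : T.Preconnected) {F : V → α} (hF : ∀ v w, T.Adj v w → F v = F w) (v w : V) :
    F v = F w := by
  obtain ⟨p⟩ := hT v w
  induction p with
  | nil => rfl
  | cons h _ ih => exact (hF _ _ h).trans ih

/-- The homomorphisms from a free group of rank `n` to `ℚ` form the image of an injective linear
map from `ℚⁿ`, which prescribes the values on the generators. -/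
lemma exists_additive_characters {Γ : Type*} [Group Γ] {n : ℕ} (e : Γ ≃* FreeGroup (Fin n)) :
    ∃ χ : (Fin n → ℚ) →ₗ[ℚ] (Γ → ℚ),
      (∀ c γ δ, χ c (γ * δ) = χ c γ + χ c δ) ∧
      (∀ c, χ c = 0 → c = 0) ∧
      ∀ ψ : Γ → ℚ, (∀ γ δ, ψ (γ * δ) = ψ γ + ψ δ) → ∃ c, χ c = ψ := by
  let hom (c : Fin n → ℚ) : FreeGroup (Fin n) →* Multiplicative ℚ :=
    FreeGroup.lift fun i => Multiplicative.ofAdd (c i)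
  have key : ∀ f g : FreeGroup (Fin n) →* Multiplicative ℚ,
      (∀ i, f (FreeGroup.of i) = g (FreeGroup.of i)) → f = g :=
    fun f g h => FreeGroup.ext_hom f g h
  refine ⟨{ toFun := fun c γ => (hom c (e γ)).toAdd
            map_add' := ?_
            map_smul' := ?_ }, ?_, ?_, ?_⟩
  · intro c d
    have : hom (c + d) = hom c * hom d := key _ _ fun i => by simp [hom]
    ext γ
    simp [this]
  · intro a c
    let sc : Multiplicative ℚ →* Multiplicative ℚ :=
      AddMonoidHom.toMultiplicative (AddMonoidHom.mulLeft a)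
    have : hom (a • c) = sc.comp (hom c) := key _ _ fun i => by simp [hom, sc]
    ext γ
    simp [this, sc]
  · intro c γ δ
    simp
  · intro c hc
    ext i
    have := congrFun hc (e.symm (FreeGroup.of i))
    simpa [hom] using this
  · intro ψ hψ
    let ψ' : Γ →* Multiplicative ℚ := MonoidHom.mk' (fun γ => Multiplicative.ofAdd (ψ γ)) (by
      intro γ δ
      simp [hψ])
    refine ⟨fun i => ψ (e.symm (FreeGroup.of i)), ?_⟩
    have : hom (fun i => ψ (e.symm (FreeGroup.of i))) = ψ'.comp e.symm.toMonoidHom :=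
      key _ _ fun i => by simp [hom, ψ']
    ext γ
    simp [this, ψ']

/-- Coordinates for a free action: a point `s i` in each orbit, and for each point `v` the
orbit `o v` and the unique group element `c v` carrying `s (o v)` to `v`. -/
lemma exists_coordinates_of_free {Γ V : Type*} [Group Γ] [MulAction Γ V]
    (hfree : ∀ (γ : Γ) (v : V), γ • v = v → γ = 1) :
    ∃ (s : MulAction.orbitRel.Quotient Γ V → V) (o : V → MulAction.orbitRel.Quotient Γ V)
      (c : V → Γ), (∀ v, c v • s (o v) = v) ∧ (∀ i, o (s i) = i) ∧ (∀ i, c (s i) = 1) ∧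
      (∀ (γ : Γ) v, o (γ • v) = o v) ∧ ∀ (γ : Γ) v, c (γ • v) = γ * c v := by
  let s : MulAction.orbitRel.Quotient Γ V → V := Quotient.out
  let o : V → MulAction.orbitRel.Quotient Γ V := fun v => Quotient.mk _ v
  have hex : ∀ v, ∃ γ : Γ, γ • s (o v) = v := by
    intro v
    have : (MulAction.orbitRel Γ V).r v (s (o v)) :=
      (MulAction.orbitRel Γ V).symm (Quotient.mk_out (s := MulAction.orbitRel Γ V) v)
    exact this
  choose c hc using hex
  have hos : ∀ i, o (s i) = i := fun i => Quotient.out_eq i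
  have hoγ : ∀ (γ : Γ) v, o (γ • v) = o v := fun γ v => Quotient.sound ⟨γ, rfl⟩
  have hinj : ∀ (γ δ : Γ) (v : V), γ • v = δ • v → γ = δ := by
    intro γ δ v h
    have := hfree (δ⁻¹ * γ) v (by rw [mul_smul, h, inv_smul_smul])
    exact (inv_mul_eq_one.1 this).symm
  refine ⟨s, o, c, hc, hos, fun i => ?_, hoγ, fun γ v => ?_⟩
  · apply hfree _ (s i)
    have := hc (s i)
    rwa [hos] at this
  · apply hinj _ _ (s (o v))
    have := hc (γ • v)
    rw [hoγ] at this
    rw [this, mul_smul, hc]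

/-- The Euler characteristic count for a free action on a regular tree, in terms of coordinates
identifying the vertex set with `Γ × Ω`. The linear map `L` below sends a function on `V` that is
invariant up to an additive character of `Γ` to its coboundary, viewed on the set `E` of oriented
edges issuing from the points `s i`, which represent the `Γ`-orbits of oriented edges. Its kernel
consists of the constants and its image of all antisymmetric functions. -/
lemma card_mul_eq_of_coordinates {Γ V Ω : Type*} [Group Γ] [MulAction Γ V]
    [Nonempty V] [Finite Ω] {n q : ℕ} (e : Γ ≃* FreeGroup (Fin n))
    (hfree : ∀ (γ : Γ) (v : V), γ • v = v → γ = 1)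
    {s : Ω → V} {o : V → Ω} {c : V → Γ} (hc : ∀ v, c v • s (o v) = v)
    (hos : ∀ i, o (s i) = i) (hcs : ∀ i, c (s i) = 1)
    (hoγ : ∀ (γ : Γ) v, o (γ • v) = o v) (hcγ : ∀ (γ : Γ) v, c (γ • v) = γ * c v)
    (T : SimpleGraph V) (hinv : ∀ (γ : Γ) v w, T.Adj v w → T.Adj (γ • v) (γ • w))
    (hreg : ∀ v, Nat.card (T.neighborSet v) = q + 1)
    (hconn : T.Preconnected) (hacyc : T.IsCohomologicallyAcyclic) :
    Nat.card Ω * (q + 1) + 2 = 2 * (Nat.card Ω + n) := by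
  classical
  obtain ⟨χ, hχmul, hχinj, hχsurj⟩ := exists_additive_characters e
  have hχone : ∀ a, χ a 1 = 0 := fun a => by simpa using hχmul a 1 1
  have hχinv : ∀ a γ, χ a γ⁻¹ = -χ a γ := fun a γ => by
    have := hχmul a γ γ⁻¹
    rw [mul_inv_cancel, hχone] at this
    linarith
  have : Fintype Ω := Fintype.ofFinite Ω
  have hfin : ∀ v, Finite (T.neighborSet v) := fun v =>
    Nat.finite_of_card_ne_zero (by rw [hreg v]; omega)
  let E := Σ i : Ω, T.neighborSet (s i)
  have : Finite E := inferInstance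
  have hE : Nat.card E = Nat.card Ω * (q + 1) := by
    rw [Nat.card_sigma]
    simp [hreg, Nat.card_eq_fintype_card]
  -- the reversal of an edge, translated back so that it issues from a representative
  let τ : E → E := fun x => ⟨o x.2, ⟨(c x.2)⁻¹ • s x.1, by
    have h := hinv (c x.2)⁻¹ _ _ x.2.2.symm
    have h2 : (c x.2)⁻¹ • (x.2 : V) = s (o x.2) := by
      rw [inv_smul_eq_iff, hc]
    rwa [h2] at h⟩⟩
  have hEext : ∀ x y : E, x.1 = y.1 → (x.2 : V) = y.2 → x = y := by
    rintro ⟨i, v, hv⟩ ⟨j, w, hw⟩ h1 h2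
    dsimp only at h1 h2
    subst h1 h2
    rfl
  have hτ : Function.Involutive τ := by
    intro x
    apply hEext
    · simp [τ, hoγ, hos]
    · simp [τ, hcγ, hcs, hc]
  have hτne : ∀ x, τ x ≠ x := by
    intro x hx
    have h1 : o (x.2 : V) = x.1 := congrArg Sigma.fst hx
    have h2 : (c x.2)⁻¹ • s x.1 = (x.2 : V) := by
      have := congrArg (fun y : E => (y.2 : V)) hx
      simpa [τ] using this
    have h3 := hc (x.2 : V)
    rw [h1] at h3
    -- the element `c x.2` would invert an edge, so its square fixes a vertex
    have h4 : c (x.2 : V) * c x.2 = 1 := by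
      apply hfree _ (s x.1)
      rw [mul_smul, h3]
      exact (inv_smul_eq_iff.1 h2).symm
    have h5 : c (x.2 : V) = 1 := by
      apply e.injective
      have : (e (c (x.2 : V))) ^ 2 = 1 := by rw [pow_two, ← map_mul, h4, map_one]
      rw [map_one]
      exact (pow_eq_one_iff_left two_ne_zero).1 this
    rw [h5, one_smul] at h3
    exact T.ne_of_adj x.2.2 h3
  -- the function with values `x.1` on the representatives and period character `χ x.2`
  let P : ((Ω → ℚ) × (Fin n → ℚ)) →ₗ[ℚ] (V → ℚ) :=
    { toFun := fun x v => x.1 (o v) + χ x.2 (c v)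
      map_add' := fun x y => by
        ext v
        simp
        ring
      map_smul' := fun a x => by
        ext v
        simp
        ring }
  have hPs : ∀ x i, P x (s i) = x.1 i := fun x i => by simp [P, hos, hcs, hχone]
  have hPγ : ∀ x γ v, P x (γ • v) = P x v + χ x.2 γ := fun x γ v => by
    simp only [P, LinearMap.coe_mk, AddHom.coe_mk, hoγ, hcγ, hχmul]
    ring
  -- the coboundary of `P x`
  let L : ((Ω → ℚ) × (Fin n → ℚ)) →ₗ[ℚ] (E → ℚ) :=
    { toFun := fun x y => P x y.2 - P x (s y.1)
      map_add' := fun x y => by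
        ext v
        simp
        ring
      map_smul' := fun a x => by
        ext v
        simp
        ring }
  have hLadj : ∀ x, L x = 0 → ∀ v w, T.Adj v w → P x v = P x w := by
    intro x hx v w hvw
    have hadj : T.Adj (s (o v)) ((c v)⁻¹ • w) := by
      have := hinv (c v)⁻¹ _ _ hvw
      rwa [inv_smul_eq_iff.2 (hc v).symm] at this
    have h1 : P x ((c v)⁻¹ • w) - P x (s (o v)) = 0 := congrFun hx ⟨o v, ⟨_, hadj⟩⟩
    have h2 := hPγ x (c v) (s (o v))
    have h3 := hPγ x (c v) ((c v)⁻¹ • w)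
    rw [hc] at h2
    rw [smul_inv_smul] at h3
    linarith
  have hker : Module.finrank ℚ (LinearMap.ker L) = 1 := by
    rw [finrank_eq_one_iff']
    have hone : ((fun _ => 1, 0) : (Ω → ℚ) × (Fin n → ℚ)) ∈ LinearMap.ker L := by
      rw [LinearMap.mem_ker]
      ext y
      simp [L, P]
    have hΩ : Nonempty Ω := ⟨o (Classical.arbitrary V)⟩
    refine ⟨⟨_, hone⟩, ?_, ?_⟩
    · intro h
      have := congrFun (congrArg (fun z => z.1.1) h) hΩ.some
      simp at this
    · rintro ⟨x, hx⟩
      have hconst := hconn.eq_of_forall_adj (hLadj x (LinearMap.mem_ker.1 hx))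
      have hx2 : x.2 = 0 := by
        apply hχinj
        ext γ
        have h1 := hPγ x γ (Classical.arbitrary V)
        have h2 := hconst (γ • Classical.arbitrary V) (Classical.arbitrary V)
        simp only [Pi.zero_apply]
        linarith
      refine ⟨x.1 hΩ.some, ?_⟩
      apply Subtype.ext
      apply Prod.ext
      · ext i
        have := hconst (s hΩ.some) (s i)
        rw [hPs, hPs] at this
        simp [this]
      · simp [hx2]
  have hrange : LinearMap.range L = antisymmetricFunctions τ := by
    apply le_antisymm
    · rintro _ ⟨x, rfl⟩ y
      have h1 := hPγ x (c y.2)⁻¹ (s y.1)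
      have h2 := hPγ x (c y.2) (s (o y.2))
      rw [hc] at h2
      rw [hχinv] at h1
      change P x ((c y.2)⁻¹ • s y.1) - P x (s (o y.2)) = -(P x y.2 - P x (s y.1))
      linarith
    · intro φ hφ
      -- extend `φ` to a `Γ`-invariant function of two vertices, zero off the edges
      let Φ : V → V → ℚ := fun v w =>
        if h : T.Adj (s (o v)) ((c v)⁻¹ • w) then φ ⟨o v, ⟨_, h⟩⟩ else 0
      have hadj : ∀ v w, T.Adj (s (o v)) ((c v)⁻¹ • w) ↔ T.Adj v w := by
        intro v w
        constructor
        · intro h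
          have := hinv (c v) _ _ h
          rwa [hc, smul_inv_smul] at this
        · intro h
          have := hinv (c v)⁻¹ _ _ h
          rwa [inv_smul_eq_iff.2 (hc v).symm] at this
      have hΦ : ∀ v w, Φ w v = -Φ v w := by
        intro v w
        by_cases h : T.Adj v w
        · have h1 := (hadj v w).2 h
          have h2 := (hadj w v).2 h.symm
          simp only [Φ, dif_pos h1, dif_pos h2]
          rw [← hφ]
          congr 1
          apply hEext
          · simp [τ, hoγ]
          · simp only [τ, hcγ, _root_.mul_inv_rev, inv_inv, mul_smul, hc]
        · have h1 := mt (hadj v w).1 h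
          have h2 := mt (hadj w v).1 fun h' => h h'.symm
          simp only [Φ, dif_neg h1, dif_neg h2, neg_zero]
      have hΦγ : ∀ (γ : Γ) v w, Φ (γ • v) (γ • w) = Φ v w := by
        intro γ v w
        by_cases h : T.Adj v w
        · have h1 := (hadj v w).2 h
          have h2 := (hadj _ _).2 (hinv γ _ _ h)
          simp only [Φ, dif_pos h1, dif_pos h2]
          congr 1
          apply hEext
          · simp [hoγ]
          · simp [hcγ, mul_smul]
        · have h1 := mt (hadj v w).1 h
          have h2 := mt (hadj (γ • v) (γ • w)).1 fun h' => h (by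
            have := hinv γ⁻¹ _ _ h'
            rwa [inv_smul_smul, inv_smul_smul] at this)
          simp only [Φ, dif_neg h1, dif_neg h2]
      obtain ⟨F, hF⟩ := hacyc Φ hΦ
      -- the periods of the primitive `F` form a homomorphism `Γ → ℚ`
      have hper : ∀ (γ : Γ) v w, F (γ • v) - F v = F (γ • w) - F w := by
        intro γ
        apply hconn.eq_of_forall_adj
        intro v w h
        have h1 := hF _ _ h
        have h2 := hF _ _ (hinv γ _ _ h)
        rw [hΦγ] at h2
        linarith
      let v₀ := Classical.arbitrary V
      obtain ⟨a, ha⟩ := hχsurj (fun γ => F (γ • v₀) - F v₀) (by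
        intro γ δ
        have := hper γ (δ • v₀) v₀
        simp only [mul_smul]
        linarith)
      have hFP : ∀ v, P (fun i => F (s i), a) v = F v := by
        intro v
        have h1 := hper (c v) (s (o v)) v₀
        rw [hc] at h1
        simp only [P, LinearMap.coe_mk, AddHom.coe_mk, ha]
        linarith
      refine ⟨(fun i => F (s i), a), ?_⟩
      ext y
      change P _ (y.2 : V) - P _ (s y.1) = _
      rw [hFP, hFP, hF _ _ y.2.2]
      have h1 := (hadj _ _).2 y.2.2
      simp only [Φ, dif_pos h1]
      congr 1
      apply hEext
      · simp [hos]
      · simp [hcs]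
  have hrn := LinearMap.finrank_range_add_finrank_ker L
  rw [hker, hrange, Module.finrank_prod, Module.finrank_fintype_fun_eq_card,
    Module.finrank_fintype_fun_eq_card, Fintype.card_fin, ← Nat.card_eq_fintype_card] at hrn
  have hhalf := two_mul_finrank_antisymmetricFunctions hτ hτne
  rw [hE] at hhalf
  omega

/-- The Euler characteristic of the quotient of a `(q + 1)`-regular tree by a free group of rank
`n` acting freely: the quotient graph has `N` vertices and `N (q + 1) / 2` edges, and its first
Betti number is `n`. -/
theorem card_orbits_mul_eq_of_free_action_on_tree {Γ V : Type*} [Group Γ] [MulAction Γ V]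
    [Nonempty V] {n q : ℕ} (e : Γ ≃* FreeGroup (Fin n))
    (hfree : ∀ (γ : Γ) (v : V), γ • v = v → γ = 1)
    (T : SimpleGraph V) (hinv : ∀ (γ : Γ) v w, T.Adj v w → T.Adj (γ • v) (γ • w))
    (hreg : ∀ v, Nat.card (T.neighborSet v) = q + 1)
    (hconn : T.Preconnected) (hacyc : T.IsCohomologicallyAcyclic)
    [Finite (MulAction.orbitRel.Quotient Γ V)] :
    Nat.card (MulAction.orbitRel.Quotient Γ V) * (q + 1) + 2 =
      2 * (Nat.card (MulAction.orbitRel.Quotient Γ V) + n) := by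
  obtain ⟨s, o, c, hc, hos, hcs, hoγ, hcγ⟩ := exists_coordinates_of_free hfree
  exact card_mul_eq_of_coordinates e hfree hc hos hcs hoγ hcγ T hinv hreg hconn hacyc

end FreeQuotient

/-! ### Graphs defined by a parent map -/

section ParentGraph

variable {V : Type*} {T : SimpleGraph V} {p : V → V}

lemma SimpleGraph.preconnected_of_parent (hadj : ∀ v w, T.Adj v w ↔ w = p v ∨ v = p w)
    (hanc : ∀ v w, ∃ i j, p^[i] v = p^[j] w) : T.Preconnected := by
  have hreach : ∀ i v, T.Reachable v (p^[i] v) := by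
    intro i v
    induction i with
    | zero => exact SimpleGraph.Reachable.refl _
    | succ i ih =>
      rw [Function.iterate_succ_apply']
      exact ih.trans ((hadj _ _).2 (Or.inl rfl)).reachable
  intro v w
  obtain ⟨i, j, h⟩ := hanc v w
  have := hreach i v
  rw [h] at this
  exact this.trans (hreach j w).symm

/-- A graph whose edges join each vertex to its parent, with no periodic vertices and such that
any two vertices have a common ancestor, has vanishing first cohomology: a primitive of `φ` is
obtained by summing `φ` along the path to a common ancestor with a fixed vertex. -/
lemma SimpleGraph.isCohomologicallyAcyclic_of_parent
    (hadj : ∀ v w, T.Adj v w ↔ w = p v ∨ v = p w)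
    (hinj : ∀ v i j, p^[i] v = p^[j] v → i = j)
    (hanc : ∀ v w, ∃ i j, p^[i] v = p^[j] w) : T.IsCohomologicallyAcyclic := by
  intro φ hφ
  rcases isEmpty_or_nonempty V with hV | ⟨⟨v₀⟩⟩
  · exact ⟨0, fun v => hV.elim v⟩
  let S : ℕ → V → ℚ := fun m v => ∑ i ∈ Finset.range m, φ (p^[i] v) (p^[i + 1] v)
  have hSadd : ∀ m j v, S (m + j) v = S m v + S j (p^[m] v) := by
    intro m j v
    simp only [S, Finset.sum_range_add]
    congr 1
    apply Finset.sum_congr rfl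
    intro i _
    rw [← Function.iterate_add_apply, ← Function.iterate_add_apply]
    congr 2 <;> ring
  choose m k hmk using fun v => hanc v v₀
  -- the sum to a common ancestor does not depend on the choice of the ancestor
  have hindep : ∀ v a b a' b', a ≤ a' → p^[a] v = p^[b] v₀ → p^[a'] v = p^[b'] v₀ →
      S b v₀ - S a v = S b' v₀ - S a' v := by
    intro v a b a' b' hle h h'
    obtain ⟨j, rfl⟩ := Nat.exists_eq_add_of_le hle
    have hb : b' = b + j := by
      apply hinj v₀
      rw [← h', add_comm a, Function.iterate_add_apply, h, ← Function.iterate_add_apply, add_comm]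
    subst hb
    rw [hSadd, hSadd, h]
    ring
  let F : V → ℚ := fun v => S (k v) v₀ - S (m v) v
  have hF : ∀ v a b, p^[a] v = p^[b] v₀ → F v = S b v₀ - S a v := by
    intro v a b h
    rcases le_total a (m v) with hle | hle
    · exact (hindep v _ _ _ _ hle h (hmk v)).symm
    · exact hindep v _ _ _ _ hle (hmk v) h
  have hFp : ∀ v, F (p v) - F v = φ v (p v) := by
    intro v
    have h := hmk (p v)
    rw [hF v (m (p v) + 1) (k (p v)) h]
    simp only [F]
    rw [add_comm (m (p v)) 1, hSadd]
    simp [S]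
  refine ⟨F, fun v w h => ?_⟩
  rcases (hadj v w).1 h with rfl | rfl
  · exact hFp v
  · rw [hφ w (p w), ← hFp]
    ring

end ParentGraph

/-! ### Uniformizers -/

section Uniformizer

variable (F : Type*) [Field F] [ValuativeRel F] [TopologicalSpace F] [IsNonarchimedeanLocalField F]

lemma exists_uniformizer : ∃ ϖ : F, ϖ ≠ 0 ∧ valuation F ϖ < 1 ∧
    (∀ x, valuation F x < 1 → valuation F x ≤ valuation F ϖ) ∧
    ∀ x ≠ 0, ∃ j : ℤ, valuation F x = valuation F ϖ ^ j := by
  obtain ⟨ϖ, hϖ⟩ := IsDiscreteValuationRing.exists_irreducible (Valuation.integer (valuation F))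
  have hi := Valuation.integer.integers (valuation F)
  have hne : (ϖ : F) ≠ 0 := fun h => hϖ.ne_zero (Subtype.ext h)
  have hlt : valuation F (ϖ : F) < 1 := by
    refine lt_of_le_of_ne ϖ.2 fun h => hϖ.not_isUnit ?_
    exact hi.isUnit_iff_valuation_eq_one.2 h
  have hpow : ∀ x : F, x ≠ 0 → valuation F x ≤ 1 →
      ∃ j : ℕ, valuation F x = valuation F (ϖ : F) ^ j := by
    intro x hx hx1
    obtain ⟨j, u, hu⟩ := IsDiscreteValuationRing.eq_unit_mul_pow_irreducible
      (x := (⟨x, hx1⟩ : Valuation.integer (valuation F))) (fun h => hx (congrArg Subtype.val h)) hϖ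
    refine ⟨j, ?_⟩
    have := congrArg (fun z : Valuation.integer (valuation F) => valuation F (z : F)) hu
    have hu1 : valuation F ((u : Valuation.integer (valuation F)) : F) = 1 :=
      hi.isUnit_iff_valuation_eq_one.1 u.isUnit
    simpa [hu1] using this
  refine ⟨ϖ, hne, hlt, fun x hx => ?_, fun x hx => ?_⟩
  · rcases eq_or_ne x 0 with rfl | hx0
    · simp
    obtain ⟨j, hj⟩ := hpow x hx0 hx.le
    rw [hj] at hx ⊢
    cases j with
    | zero => simp at hx
    | succ j => exact pow_le_of_le_one zero_le hlt.le (Nat.succ_ne_zero j)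
  · rcases le_total (valuation F x) 1 with h | h
    · obtain ⟨j, hj⟩ := hpow x hx h
      exact ⟨j, by simpa using hj⟩
    · obtain ⟨j, hj⟩ := hpow x⁻¹ (inv_ne_zero hx) (by
        rw [map_inv₀]
        exact inv_le_one_of_one_le₀ h)
      refine ⟨-j, ?_⟩
      rw [_root_.zpow_neg, zpow_natCast, ← hj, map_inv₀, inv_inv]

end Uniformizer

/-! ### Vertices of the Bruhat–Tits tree as balls -/

section Cosets

variable {F : Type*} [Field F] [ValuativeRel F]

open ProjGenLinGroup

/-- A class lies in `PGL(2, 𝒪)` exactly if it has a representative with integral entries and unit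
determinant. -/
lemma mk_mem_integralPGL_iff (g : GL (Fin 2) F) : mk g ∈ integralPGL F ↔
    ∃ u : F, (∀ i j, valuation F (u * g i j) ≤ 1) ∧ valuation F (u ^ 2 * g.1.det) = 1 := by
  have hi := Valuation.integer.integers (valuation F)
  constructor
  · rintro ⟨k, hk⟩
    obtain ⟨u, hu⟩ := mk_eq_mk_iff.1 hk.symm
    have hM : ∀ i j, (u : F) * g i j = (k i j : F) := by
      intro i j
      have := congrArg (fun h : GL (Fin 2) F => h i j) hu
      simpa [mul_comm, GeneralLinearGroup.scalar, Matrix.scalar] using this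
    refine ⟨u, fun i j => ?_, ?_⟩
    · rw [hM]
      exact (k i j).2
    · have : (u : F) ^ 2 * g.1.det = (k.1.det : F) := by
        rw [Matrix.det_fin_two, Matrix.det_fin_two]
        push_cast
        rw [← hM, ← hM, ← hM, ← hM]
        ring
      rw [this]
      exact hi.isUnit_iff_valuation_eq_one.1 ((Matrix.isUnit_iff_isUnit_det _).1 k.isUnit)
  · rintro ⟨u, hent, hdet⟩
    have hu : u ≠ 0 := by
      rintro rfl
      simp at hdet
    let N : Matrix (Fin 2) (Fin 2) (Valuation.integer (valuation F)) :=
      fun i j => ⟨u * g i j, hent i j⟩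
    have hN : IsUnit N.det := by
      apply hi.isUnit_iff_valuation_eq_one.2
      have : (N.det : F) = u ^ 2 * g.1.det := by
        rw [Matrix.det_fin_two, Matrix.det_fin_two]
        simp only [N, AddSubgroupClass.coe_sub, MulMemClass.coe_mul]
        ring
      change valuation F (N.det : F) = 1
      rw [this, hdet]
    refine ⟨GeneralLinearGroup.mk'' N hN, ?_⟩
    symm
    refine mk_eq_mk_iff.2 ⟨Units.mk0 u hu, ?_⟩
    ext i j
    simp [N, mul_comm, GeneralLinearGroup.scalar, Matrix.scalar]
    rfl

end Cosets

section Vertices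

variable {F : Type*} [Field F]

/-- The matrix of the affine map `x ↦ a x + b`. -/
def affineGL (a : Fˣ) (b : F) : GL (Fin 2) F :=
  GeneralLinearGroup.mkOfDetNeZero !![(a : F), b; 0, 1] (by simp)

lemma affineGL_mul (a a' : Fˣ) (b b' : F) :
    affineGL a b * affineGL a' b' = affineGL (a * a') (a * b' + b) := by
  ext i j
  fin_cases i <;> fin_cases j <;>
    simp [affineGL, GeneralLinearGroup.mkOfDetNeZero, Matrix.mul_apply, Fin.sum_univ_two]

variable [ValuativeRel F]

open ProjGenLinGroup

/-- The coset of the matrix of `x ↦ a x + b` in `PGL(2, F) / PGL(2, 𝒪)`. It depends only on the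
closed ball of centre `b` and radius `|a|`. -/
noncomputable def ballVertex (a : Fˣ) (b : F) : PGL(2, F) ⧸ integralPGL F :=
  (mk (affineGL a b) : PGL(2, F))

lemma ballVertex_eq_iff {a a' : Fˣ} {b b' : F} : ballVertex a b = ballVertex a' b' ↔
    valuation F a = valuation F a' ∧ valuation F (b - b') ≤ valuation F a := by
  have hva : valuation F (a : F) ≠ 0 := by simp
  have hmul : (affineGL a b)⁻¹ * affineGL a' b' = affineGL (a⁻¹ * a') ((b' - b) / a) := by
    rw [inv_mul_eq_iff_eq_mul, affineGL_mul]
    congr 1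
    · simp
    · field_simp
      ring
  have hentries : ∀ u : F, (∀ i j, valuation F (u * affineGL (a⁻¹ * a') ((b' - b) / a) i j) ≤ 1) ↔
      valuation F (u * ((a : F)⁻¹ * a')) ≤ 1 ∧ valuation F (u * ((b' - b) / a)) ≤ 1 ∧
        valuation F u ≤ 1 := by
    intro u
    simp [affineGL, GeneralLinearGroup.mkOfDetNeZero, Fin.forall_fin_two, and_assoc]
  have hdet : (affineGL (a⁻¹ * a') ((b' - b) / a)).1.det = (a : F)⁻¹ * a' := by
    simp [affineGL, GeneralLinearGroup.mkOfDetNeZero]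
  rw [ballVertex, ballVertex, QuotientGroup.eq, ← map_inv, ← map_mul, hmul, mk_mem_integralPGL_iff]
  simp only [hentries, hdet]
  have hval : valuation F ((a : F)⁻¹ * a') = 1 ↔ valuation F (a : F) = valuation F (a' : F) := by
    rw [map_mul, map_inv₀, inv_mul_eq_one₀ hva]
  have hval' : valuation F ((b' - b) / a) ≤ 1 ↔ valuation F (b - b') ≤ valuation F (a : F) := by
    rw [map_div₀, div_le_one₀ (zero_lt_iff.2 hva), Valuation.map_sub_swap]
  rw [← hval, ← hval']
  constructor
  · rintro ⟨u, ⟨h1, h2, h3⟩, h4⟩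
    have h5 : valuation F u * valuation F (u * ((a : F)⁻¹ * a')) = 1 := by
      rw [← map_mul, ← h4]
      congr 1
      ring
    have h6 : valuation F u = 1 := by
      refine le_antisymm h3 ?_
      rw [← h5]
      exact mul_le_of_le_one_right' h1
    rw [h6, one_mul, map_mul, h6, one_mul] at h5
    rw [map_mul, h6, one_mul] at h2
    exact ⟨h5, h2⟩
  · rintro ⟨h1, h2⟩
    exact ⟨1, by simp [h1, h2, -map_mul, -map_div₀], by simp [h1, -map_mul]⟩

/-- Right multiplication by the permutation matrix does not change the vertex. -/
lemma coe_mk_mul_swap (g : GL (Fin 2) F) :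
    ((mk (g * GeneralLinearGroup.mkOfDetNeZero !![0, 1; 1, 0] (by simp)) : PGL(2, F)) :
      PGL(2, F) ⧸ integralPGL F) = (mk g : PGL(2, F)) := by
  rw [QuotientGroup.eq, ← map_inv, ← map_mul, _root_.mul_inv_rev, mul_assoc, inv_mul_cancel, mul_one,
    map_inv, inv_mem_iff, mk_mem_integralPGL_iff]
  refine ⟨1, ?_, ?_⟩
  · simp [GeneralLinearGroup.mkOfDetNeZero, Fin.forall_fin_two]
  · simp [GeneralLinearGroup.mkOfDetNeZero, Valuation.map_neg]

/-- The Iwasawa decomposition: the column operation clearing the smaller bottom entry. -/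
lemma coe_mk_eq_ballVertex (g : GL (Fin 2) F) (hg : valuation F (g 1 0) ≤ valuation F (g 1 1))
    (d : Fˣ) (hd : (d : F) = g 1 1) :
    ((mk g : PGL(2, F)) : PGL(2, F) ⧸ integralPGL F) =
      ballVertex (GeneralLinearGroup.det g / d ^ 2) (g 0 1 / d) := by
  symm
  have hdet : (GeneralLinearGroup.det g : F) = g 0 0 * g 1 1 - g 0 1 * g 1 0 :=
    Matrix.det_fin_two _
  have hmul : (affineGL (GeneralLinearGroup.det g / d ^ 2) (g 0 1 / d))⁻¹ * g =
      GeneralLinearGroup.mkOfDetNeZero !![(d : F), 0; g 1 0, d] (by simp) := by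
    rw [inv_mul_eq_iff_eq_mul]
    have hd0 : (d : F) ≠ 0 := d.ne_zero
    ext i j
    fin_cases i <;> fin_cases j <;>
      simp [affineGL, GeneralLinearGroup.mkOfDetNeZero, Matrix.mul_apply, Fin.sum_univ_two, hd,
        -GeneralLinearGroup.val_det_apply, hdet] <;> field_simp <;> simp [← hd]
  rw [ballVertex, QuotientGroup.eq, ← map_inv, ← map_mul, hmul, mk_mem_integralPGL_iff]
  have hvd : valuation F (d : F) ≠ 0 := by simp
  refine ⟨(d : F)⁻¹, ?_, ?_⟩
  · have : (valuation F (d : F))⁻¹ * valuation F (g 1 0) ≤ 1 := by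
      rw [inv_mul_le_one₀ (zero_lt_iff.2 hvd), hd]
      exact hg
    simp [GeneralLinearGroup.mkOfDetNeZero, Fin.forall_fin_two, this]
  · simp [GeneralLinearGroup.mkOfDetNeZero]
    field_simp

lemma exists_eq_ballVertex (x : PGL(2, F) ⧸ integralPGL F) : ∃ a b, x = ballVertex a b := by
  obtain ⟨x, rfl⟩ := QuotientGroup.mk_surjective x
  obtain ⟨g, rfl⟩ := mk_surjective x
  have key : ∀ g : GL (Fin 2) F, valuation F (g 1 0) ≤ valuation F (g 1 1) →
      ∃ a b, ((mk g : PGL(2, F)) : PGL(2, F) ⧸ integralPGL F) = ballVertex a b := by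
    intro g hg
    have h : g 1 1 ≠ 0 := by
      intro h
      have h' : g 1 0 = 0 := by simpa [h] using hg
      have hdet : (GeneralLinearGroup.det g : F) = g 0 0 * g 1 1 - g 0 1 * g 1 0 :=
        Matrix.det_fin_two _
      rw [h, h', mul_zero, mul_zero, sub_zero] at hdet
      exact (GeneralLinearGroup.det g).ne_zero hdet
    exact ⟨_, _, coe_mk_eq_ballVertex g hg (Units.mk0 _ h) rfl⟩
  rcases le_total (valuation F (g 1 0)) (valuation F (g 1 1)) with h | h
  · exact key g h
  · rw [← coe_mk_mul_swap]
    apply key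
    simpa [GeneralLinearGroup.mkOfDetNeZero, Matrix.mul_apply, Fin.sum_univ_two] using h

end Vertices

/-! ### The Bruhat–Tits tree -/

section Tree

variable {F : Type*} [Field F] [ValuativeRel F]

open ProjGenLinGroup

/-- A uniformizer of a discretely valued field: a generator of the maximal ideal, whose powers
represent all nonzero values. -/
structure IsUniformizer (ϖ : Fˣ) : Prop where
  lt_one : valuation F (ϖ : F) < 1
  le_of_lt_one : ∀ x : F, valuation F x < 1 → valuation F x ≤ valuation F (ϖ : F)
  exists_zpow : ∀ x : F, x ≠ 0 → ∃ j : ℤ, valuation F x = valuation F (ϖ : F) ^ j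

/-- The Bruhat–Tits tree of `PGL(2, F)`: the vertices `gK`, where `K = PGL(2, 𝒪)`, and `gtK` are
adjacent when `t` is the class of an integral matrix whose determinant is a uniformizer. -/
def bruhatTitsTree (ϖ : Fˣ) : SimpleGraph (PGL(2, F) ⧸ integralPGL F) :=
  SimpleGraph.fromRel fun x y => ∃ g t : GL (Fin 2) F,
    (∀ i j, valuation F (t i j) ≤ 1) ∧ valuation F t.1.det = valuation F (ϖ : F) ∧
      x = (mk g : PGL(2, F)) ∧ y = (mk (g * t) : PGL(2, F))

lemma bruhatTitsTree_adj_smul (ϖ : Fˣ) (h : PGL(2, F)) (x y : PGL(2, F) ⧸ integralPGL F)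
    (hxy : (bruhatTitsTree ϖ).Adj x y) : (bruhatTitsTree ϖ).Adj (h • x) (h • y) := by
  obtain ⟨h, rfl⟩ := mk_surjective h
  rw [bruhatTitsTree, SimpleGraph.fromRel_adj] at hxy ⊢
  refine ⟨fun e => hxy.1 (MulAction.injective _ e), ?_⟩
  refine hxy.2.imp ?_ ?_ <;>
  · rintro ⟨g, t, h1, h2, rfl, rfl⟩
    exact ⟨h * g, t, h1, h2, by rw [map_mul]; rfl, by rw [mul_assoc, map_mul]; rfl⟩

/-- The parent of a vertex of the Bruhat–Tits tree: the neighbour in the direction of the point at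
infinity, which enlarges the radius of a ball by one step. Centre and radius are chosen arbitrarily; by
`ballParent_ballVertex` the choice does not matter. -/
noncomputable def ballParent (ϖ : Fˣ) (x : PGL(2, F) ⧸ integralPGL F) :
    PGL(2, F) ⧸ integralPGL F :=
  ballVertex ((exists_eq_ballVertex x).choose / ϖ) (exists_eq_ballVertex x).choose_spec.choose

lemma IsUniformizer.div_le {ϖ : Fˣ} (hϖ : IsUniformizer ϖ) (a : Fˣ) :
    valuation F (a : F) ≤ valuation F ((a / ϖ : Fˣ) : F) := by
  rw [Units.val_div_eq_div_val, map_div₀]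
  have hϖ0 : valuation F (ϖ : F) ≠ 0 := by simp
  rw [le_div_iff₀ (zero_lt_iff.2 hϖ0)]
  exact mul_le_of_le_one_right' hϖ.lt_one.le

lemma ballParent_ballVertex {ϖ : Fˣ} (hϖ : IsUniformizer ϖ) (a : Fˣ) (b : F) :
    ballParent ϖ (ballVertex a b) = ballVertex (a / ϖ) b := by
  have h := (exists_eq_ballVertex (ballVertex a b)).choose_spec.choose_spec
  obtain ⟨h1, h2⟩ := ballVertex_eq_iff.1 h
  rw [ballParent, eq_comm, ballVertex_eq_iff]
  refine ⟨?_, h2.trans (hϖ.div_le a)⟩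
  rw [Units.val_div_eq_div_val, Units.val_div_eq_div_val, map_div₀, map_div₀, h1]

lemma iterate_ballParent_ballVertex {ϖ : Fˣ} (hϖ : IsUniformizer ϖ) (a : Fˣ) (b : F) (i : ℕ) :
    (ballParent ϖ)^[i] (ballVertex a b) = ballVertex (a / ϖ ^ i) b := by
  induction i with
  | zero => simp
  | succ i ih =>
    rw [Function.iterate_succ_apply', ih, ballParent_ballVertex hϖ, pow_succ, div_div]

/-- The neighbours of a vertex given by a specified matrix `affineGL a b`: an integral matrix of
uniformizing determinant leads to the next larger ball or to a maximal proper sub-ball. -/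
lemma coe_mk_mul_eq_parent_or_child {ϖ : Fˣ} (hϖ : IsUniformizer ϖ) (a : Fˣ) (b : F)
    (t : GL (Fin 2) F) (ht : ∀ i j, valuation F (t i j) ≤ 1)
    (hdet : valuation F t.1.det = valuation F (ϖ : F)) :
    ((mk (affineGL a b * t) : PGL(2, F)) : PGL(2, F) ⧸ integralPGL F) = ballVertex (a / ϖ) b ∨
    ∃ c, valuation F c ≤ 1 ∧ ((mk (affineGL a b * t) : PGL(2, F)) : PGL(2, F) ⧸ integralPGL F) =
      ballVertex (a * ϖ) (b + a * c) := by
  -- swapping the columns of `t` does not change the vertex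
  wlog hle : valuation F (t 1 0) ≤ valuation F (t 1 1) generalizing t
  · have := this (t * GeneralLinearGroup.mkOfDetNeZero !![0, 1; 1, 0] (by simp)) (by
        simpa [GeneralLinearGroup.mkOfDetNeZero, Matrix.mul_apply, Fin.sum_univ_two,
          Fin.forall_fin_two, and_comm] using ht)
      (by simpa [GeneralLinearGroup.mkOfDetNeZero, Valuation.map_neg] using hdet)
      (by simpa [GeneralLinearGroup.mkOfDetNeZero, Matrix.mul_apply, Fin.sum_univ_two] using
        (not_le.1 hle).le)
    simpa only [← mul_assoc, coe_mk_mul_swap] using this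
  have hd2 : t.1.det = t 0 0 * t 1 1 - t 0 1 * t 1 0 := Matrix.det_fin_two _
  have hϖ0 : valuation F (ϖ : F) ≠ 0 := by simp
  have hϖle : valuation F (ϖ : F) ≤ valuation F (t 1 1) := by
    rw [← hdet, hd2]
    refine (Valuation.map_sub _ _ _).trans (max_le ?_ ?_)
    · rw [map_mul]
      exact mul_le_of_le_one_left' (ht 0 0)
    · rw [map_mul]
      exact (mul_le_of_le_one_left' (ht 0 1)).trans hle
  have h11 : t 1 1 ≠ 0 := by
    intro h
    rw [h, map_zero] at hϖle
    exact hϖ0 (le_antisymm hϖle zero_le)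
  set d : Fˣ := Units.mk0 _ h11 with hd
  have hv : valuation F ((GeneralLinearGroup.det t : Fˣ) : F) = valuation F (ϖ : F) := hdet
  have hvd : valuation F (d : F) ≠ 0 := by simp
  have hcoe := coe_mk_eq_ballVertex (affineGL a b * t) (by
    simpa [affineGL, GeneralLinearGroup.mkOfDetNeZero, Matrix.mul_apply, Fin.sum_univ_two]
      using hle) d (by
    simp [hd, affineGL, GeneralLinearGroup.mkOfDetNeZero, Matrix.mul_apply, Fin.sum_univ_two])
  have hdetmul : GeneralLinearGroup.det (affineGL a b * t) = a * GeneralLinearGroup.det t := by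
    rw [map_mul]
    congr 1
    ext
    simp [affineGL, GeneralLinearGroup.mkOfDetNeZero]
  have hcen : (affineGL a b * t) 0 1 / (d : F) = b + a * (t 0 1 / d) := by
    simp [hd, affineGL, GeneralLinearGroup.mkOfDetNeZero, Matrix.mul_apply, Fin.sum_univ_two]
    field_simp
    ring
  rw [hcoe, hdetmul, hcen]
  have hrad : valuation F ((a * GeneralLinearGroup.det t / d ^ 2 : Fˣ) : F) =
      valuation F (a : F) * valuation F (ϖ : F) / valuation F (d : F) ^ 2 := by
    rw [Units.val_div_eq_div_val, Units.val_mul, map_div₀, map_mul, hv, Units.val_pow_eq_pow_val,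
      map_pow]
  rcases (ht 1 1).lt_or_eq with h1 | h1
  · -- the bottom row vanishes modulo the uniformizer
    left
    have hdϖ : valuation F (d : F) = valuation F (ϖ : F) :=
      le_antisymm (hϖ.le_of_lt_one _ h1) hϖle
    rw [ballVertex_eq_iff, hrad, hdϖ]
    have hr : valuation F (a : F) * valuation F (ϖ : F) / valuation F (ϖ : F) ^ 2 =
        valuation F (a : F) / valuation F (ϖ : F) := by
      field_simp
    rw [hr]
    refine ⟨by rw [Units.val_div_eq_div_val, map_div₀], ?_⟩
    rw [add_sub_cancel_left, map_mul, map_div₀, hdϖ, div_eq_mul_inv, ← mul_assoc, div_eq_mul_inv]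
    gcongr
    exact mul_le_of_le_one_right' (ht 0 1)
  · right
    have hd1 : valuation F (d : F) = 1 := h1
    refine ⟨t 0 1 / d, ?_, ?_⟩
    · rw [map_div₀, hd1, div_one]
      exact ht 0 1
    · rw [ballVertex_eq_iff, hrad, hd1]
      simp

/-- The conclusion of `coe_mk_mul_eq_parent_or_child` for an arbitrary representative `g` of the
vertex. -/
lemma bruhatTitsTree_rel_ballVertex {ϖ : Fˣ} (hϖ : IsUniformizer ϖ) (a : Fˣ) (b : F)
    (g t : GL (Fin 2) F) (ht : ∀ i j, valuation F (t i j) ≤ 1)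
    (hdet : valuation F t.1.det = valuation F (ϖ : F))
    (hg : ballVertex a b = (mk g : PGL(2, F))) :
    ((mk (g * t) : PGL(2, F)) : PGL(2, F) ⧸ integralPGL F) = ballVertex (a / ϖ) b ∨
    ∃ c, valuation F c ≤ 1 ∧ ((mk (g * t) : PGL(2, F)) : PGL(2, F) ⧸ integralPGL F) =
      ballVertex (a * ϖ) (b + a * c) := by
  rw [ballVertex, QuotientGroup.eq, ← map_inv, ← map_mul, mk_mem_integralPGL_iff] at hg
  obtain ⟨u, hu1, hu2⟩ := hg
  have hu : u ≠ 0 := by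
    rintro rfl
    simp at hu2
  -- `g t` is, up to a scalar, the product of `affineGL a b` and an integral matrix
  let t' : GL (Fin 2) F := GeneralLinearGroup.scalar (Fin 2) (Units.mk0 u hu) *
    ((affineGL a b)⁻¹ * g) * t
  have hmk : (mk (g * t) : PGL(2, F)) = mk (affineGL a b * t') := by
    simp only [t', map_mul, mk_scalar, ← mul_assoc]
    simp
  rw [hmk]
  refine coe_mk_mul_eq_parent_or_child hϖ a b t' ?_ ?_
  · have hent : ∀ i j, t' i j = u * ((affineGL a b)⁻¹ * g) i 0 * t 0 j +
        u * ((affineGL a b)⁻¹ * g) i 1 * t 1 j := by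
      intro i j
      simp only [t', Units.val_mul, GeneralLinearGroup.coe_scalar]
      fin_cases i <;> simp [Matrix.mul_apply, Fin.sum_univ_two]
    intro i j
    rw [hent]
    refine (Valuation.map_add _ _ _).trans (max_le ?_ ?_) <;>
    · rw [map_mul]
      exact mul_le_one' (hu1 _ _) (ht _ _)
  · have : t'.1.det = (u ^ 2 * ((affineGL a b)⁻¹ * g).1.det) * t.1.det := by
      simp only [t', Units.val_mul, Matrix.det_mul, GeneralLinearGroup.coe_scalar]
      simp
    rw [this, map_mul, hu2, one_mul, hdet]

lemma ballVertex_div_ne {ϖ : Fˣ} (hϖ : IsUniformizer ϖ) (a : Fˣ) (b b' : F) :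
    ballVertex (a / ϖ) b ≠ ballVertex a b' := by
  intro h
  have h1 := (ballVertex_eq_iff.1 h).1
  have hva : valuation F (a : F) ≠ 0 := by simp
  have hvϖ : valuation F (ϖ : F) ≠ 0 := by simp
  rw [Units.val_div_eq_div_val, map_div₀, div_eq_iff hvϖ] at h1
  exact hϖ.lt_one.ne (mul_left_cancel₀ hva (by rw [mul_one]; exact h1.symm))

/-- The edges of the Bruhat–Tits tree join each vertex to its parent. -/
lemma bruhatTitsTree_adj_iff {ϖ : Fˣ} (hϖ : IsUniformizer ϖ) (x y : PGL(2, F) ⧸ integralPGL F) :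
    (bruhatTitsTree ϖ).Adj x y ↔ y = ballParent ϖ x ∨ x = ballParent ϖ y := by
  have key : ∀ x y : PGL(2, F) ⧸ integralPGL F, (∃ g t : GL (Fin 2) F,
      (∀ i j, valuation F (t i j) ≤ 1) ∧ valuation F t.1.det = valuation F (ϖ : F) ∧
      x = (mk g : PGL(2, F)) ∧ y = (mk (g * t) : PGL(2, F))) →
      y = ballParent ϖ x ∨ x = ballParent ϖ y := by
    rintro x y ⟨g, t, ht, hdet, hx, rfl⟩
    obtain ⟨a, b, rfl⟩ := exists_eq_ballVertex x
    rcases bruhatTitsTree_rel_ballVertex hϖ a b g t ht hdet hx with h | ⟨c, hc, h⟩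
    · left
      rw [h, ballParent_ballVertex hϖ]
    · right
      rw [h, ballParent_ballVertex hϖ, ballVertex_eq_iff]
      simp only [mul_div_cancel_right, sub_add_cancel_left, map_mul, Valuation.map_neg, true_and]
      exact mul_le_of_le_one_right' hc
  have key' : ∀ x : PGL(2, F) ⧸ integralPGL F, ∃ g t : GL (Fin 2) F,
      (∀ i j, valuation F (t i j) ≤ 1) ∧ valuation F t.1.det = valuation F (ϖ : F) ∧
      x = (mk g : PGL(2, F)) ∧ ballParent ϖ x = (mk (g * t) : PGL(2, F)) := by
    intro x
    obtain ⟨a, b, rfl⟩ := exists_eq_ballVertex x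
    refine ⟨affineGL a b, GeneralLinearGroup.mkOfDetNeZero !![1, 0; 0, (ϖ : F)] (by simp),
      ?_, ?_, rfl, ?_⟩
    · simp [GeneralLinearGroup.mkOfDetNeZero, Fin.forall_fin_two, hϖ.lt_one.le]
    · simp [GeneralLinearGroup.mkOfDetNeZero]
    · rw [ballParent_ballVertex hϖ, ballVertex]
      congr 1
      refine mk_eq_mk_iff.2 ⟨ϖ, ?_⟩
      ext i j
      fin_cases i <;> fin_cases j <;> simp [affineGL, GeneralLinearGroup.mkOfDetNeZero,
        Matrix.mul_apply, Fin.sum_univ_two, GeneralLinearGroup.scalar, Matrix.scalar]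
  have hne : ∀ x, ballParent ϖ x ≠ x := by
    intro x
    obtain ⟨a, b, rfl⟩ := exists_eq_ballVertex x
    rw [ballParent_ballVertex hϖ]
    exact ballVertex_div_ne hϖ a b b
  rw [bruhatTitsTree, SimpleGraph.fromRel_adj]
  constructor
  · rintro ⟨-, h | h⟩
    · exact key x y h
    · exact (key y x h).symm
  · rintro (rfl | rfl)
    · exact ⟨(hne x).symm, Or.inl (key' x)⟩
    · exact ⟨hne y, Or.inr (key' y)⟩

lemma iterate_ballParent_injective {ϖ : Fˣ} (hϖ : IsUniformizer ϖ)
    (x : PGL(2, F) ⧸ integralPGL F) (i j : ℕ)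
    (h : (ballParent ϖ)^[i] x = (ballParent ϖ)^[j] x) : i = j := by
  obtain ⟨a, b, rfl⟩ := exists_eq_ballVertex x
  rw [iterate_ballParent_ballVertex hϖ, iterate_ballParent_ballVertex hϖ] at h
  have h1 := (ballVertex_eq_iff.1 h).1
  have hva : valuation F (a : F) ≠ 0 := by simp
  rw [Units.val_div_eq_div_val, Units.val_div_eq_div_val, map_div₀, map_div₀,
    div_eq_mul_inv, div_eq_mul_inv, mul_right_inj' hva, _root_.inv_inj, Units.val_pow_eq_pow_val,
    Units.val_pow_eq_pow_val, map_pow, map_pow] at h1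
  have hϖ0 : valuation F (ϖ : F) ≠ 0 := by simp
  exact (pow_right_strictAnti₀ (zero_lt_iff.2 hϖ0) hϖ.lt_one).injective h1

lemma exists_common_ancestor {ϖ : Fˣ} (hϖ : IsUniformizer ϖ)
    (x y : PGL(2, F) ⧸ integralPGL F) :
    ∃ i j, (ballParent ϖ)^[i] x = (ballParent ϖ)^[j] y := by
  obtain ⟨a, b, rfl⟩ := exists_eq_ballVertex x
  obtain ⟨a', b', rfl⟩ := exists_eq_ballVertex y
  obtain ⟨k, hk⟩ := hϖ.exists_zpow a a.ne_zero
  obtain ⟨k', hk'⟩ := hϖ.exists_zpow a' a'.ne_zero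
  have hϖ0 : valuation F (ϖ : F) ≠ 0 := by simp
  obtain ⟨l, hl⟩ : ∃ l : ℤ, valuation F (b - b') ≤ valuation F (ϖ : F) ^ l := by
    rcases eq_or_ne (b - b') 0 with h | h
    · exact ⟨0, by simp [h]⟩
    · obtain ⟨l, hl⟩ := hϖ.exists_zpow _ h
      exact ⟨l, hl.le⟩
  -- enlarge both balls to a common radius that is at least the distance of their centres
  obtain ⟨i, hi⟩ : ∃ i : ℕ, (i : ℤ) = k - min l (min k k') :=
    Int.eq_ofNat_of_zero_le (by omega) |>.imp fun _ h => h.symm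
  obtain ⟨j, hj⟩ : ∃ j : ℕ, (j : ℤ) = k' - min l (min k k') :=
    Int.eq_ofNat_of_zero_le (by omega) |>.imp fun _ h => h.symm
  have hrad : ∀ (a : Fˣ) (k : ℤ) (i : ℕ), valuation F (a : F) = valuation F (ϖ : F) ^ k →
      valuation F ((a / ϖ ^ i : Fˣ) : F) = valuation F (ϖ : F) ^ (k - i) := by
    intro a k i h
    rw [Units.val_div_eq_div_val, map_div₀, h, Units.val_pow_eq_pow_val, map_pow, zpow_sub₀ hϖ0,
      zpow_natCast]
  refine ⟨i, j, ?_⟩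
  rw [iterate_ballParent_ballVertex hϖ, iterate_ballParent_ballVertex hϖ, ballVertex_eq_iff,
    hrad a k i hk, hrad a' k' j hk']
  refine ⟨by congr 1; omega, hl.trans ?_⟩
  exact zpow_le_zpow_right_of_le_one₀ (zero_lt_iff.2 hϖ0) hϖ.lt_one.le (by omega)

/-- Each vertex has `q + 1` neighbours: its parent and the `q` maximal proper sub-balls, which
are indexed by the residue field. -/
lemma card_neighborSet_bruhatTitsTree [Finite (IsLocalRing.ResidueField
    (Valuation.integer (valuation F)))] {ϖ : Fˣ} (hϖ : IsUniformizer ϖ)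
    (x : PGL(2, F) ⧸ integralPGL F) :
    Nat.card ((bruhatTitsTree ϖ).neighborSet x) = residueCard F + 1 := by
  obtain ⟨a, b, rfl⟩ := exists_eq_ballVertex x
  have hi := Valuation.integer.integers (valuation F)
  have hva : valuation F (a : F) ≠ 0 := by simp
  have hres : ∀ c d : Valuation.integer (valuation F),
      IsLocalRing.residue _ c = IsLocalRing.residue _ d ↔
        valuation F ((c : F) - d) ≤ valuation F (ϖ : F) := by
    intro c d
    rw [← sub_eq_zero, ← map_sub, IsLocalRing.residue_eq_zero_iff, IsLocalRing.mem_maximalIdeal,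
      mem_nonunits_iff, hi.isUnit_iff_valuation_eq_one]
    change ¬ valuation F ((c : F) - d) = 1 ↔ _
    have hle : valuation F ((c : F) - d) ≤ 1 := (c - d).2
    constructor
    · exact fun h => hϖ.le_of_lt_one _ (lt_of_le_of_ne hle h)
    · exact fun h => (h.trans_lt hϖ.lt_one).ne
  have hchild : ∀ c d : F, ballVertex (a * ϖ) (b + a * c) = ballVertex (a * ϖ) (b + a * d) ↔
      valuation F (c - d) ≤ valuation F (ϖ : F) := by
    intro c d
    rw [ballVertex_eq_iff, add_sub_add_left_eq_sub, ← mul_sub, Units.val_mul, map_mul, map_mul,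
      mul_le_mul_iff_right₀ (zero_lt_iff.2 hva)]
    simp
  let lift : IsLocalRing.ResidueField (Valuation.integer (valuation F)) →
    Valuation.integer (valuation F) := Function.surjInv IsLocalRing.residue_surjective
  have hlift : ∀ r, IsLocalRing.residue _ (lift r) = r := Function.surjInv_eq _
  -- `none` is sent to the parent, and residue classes to the children
  let f : Option (IsLocalRing.ResidueField (Valuation.integer (valuation F))) →
      PGL(2, F) ⧸ integralPGL F
    | none => ballVertex (a / ϖ) b
    | some r => ballVertex (a * ϖ) (b + a * (lift r : F))
  have hpc : ∀ c, ballVertex (a / ϖ) b ≠ ballVertex (a * ϖ) c := by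
    intro c h
    have h1 := (ballVertex_eq_iff.1 h).1
    have h2 := hϖ.div_le a
    rw [h1, Units.val_mul, map_mul] at h2
    have h3 : valuation F (a : F) * valuation F (ϖ : F) < valuation F (a : F) :=
      mul_lt_of_lt_one_right (zero_lt_iff.2 hva) hϖ.lt_one
    exact absurd h2 (not_le.2 h3)
  have hf : Function.Injective f := by
    rintro (_ | r) (_ | s) h
    · rfl
    · exact absurd h (hpc _)
    · exact absurd h.symm (hpc _)
    · rw [hchild, ← hres, hlift, hlift] at h
      rw [h]
  have hrange : Set.range f = (bruhatTitsTree ϖ).neighborSet (ballVertex a b) := by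
    ext y
    rw [SimpleGraph.mem_neighborSet, bruhatTitsTree_adj_iff hϖ, ballParent_ballVertex hϖ]
    constructor
    · rintro ⟨_ | r, rfl⟩
      · exact Or.inl rfl
      · right
        rw [ballParent_ballVertex hϖ, ballVertex_eq_iff]
        simp only [mul_div_cancel_right, sub_add_cancel_left, map_mul, Valuation.map_neg, true_and]
        exact mul_le_of_le_one_right' (lift r).2
    · rintro (rfl | h)
      · exact ⟨none, rfl⟩
      · obtain ⟨a', b', rfl⟩ := exists_eq_ballVertex y
        rw [ballParent_ballVertex hϖ, ballVertex_eq_iff] at h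
        obtain ⟨h1, h2⟩ := h
        let c : Valuation.integer (valuation F) := ⟨(b' - b) / a, by
          rw [Valuation.mem_integer_iff, map_div₀, div_le_one₀ (zero_lt_iff.2 hva),
            Valuation.map_sub_swap]
          exact h2⟩
        refine ⟨some (IsLocalRing.residue _ c), ?_⟩
        have h3 : ballVertex (a * ϖ) (b + a * (c : F)) = ballVertex a' b' := by
          rw [ballVertex_eq_iff, Units.val_mul, map_mul, h1, Units.val_div_eq_div_val, map_div₀]
          refine ⟨div_mul_cancel₀ _ (by simp), ?_⟩
          have : b + a * (c : F) - b' = 0 := by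
            simp only [c]
            field_simp
            ring
          rw [this, map_zero]
          exact zero_le
        rw [← h3]
        exact (hchild _ _).2 ((hres _ _).1 (hlift _))
  rw [← hrange, ← Nat.card_congr (Equiv.ofInjective f hf), Finite.card_option, residueCard]

end Tree

/-! ### Coset spaces of locally compact groups -/

section CosetSpace

variable {G : Type*} [Group G] [TopologicalSpace G] [IsTopologicalGroup G]

lemma t2Space_quotient_of_isClosed {Γ : Subgroup G} (hΓ : IsClosed (Γ : Set G)) :
    T2Space (G ⧸ Γ) := by
  rw [t2Space_iff_of_isOpenQuotientMap QuotientGroup.isOpenQuotientMap_mk]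
  have : {q : G × G | (q.1 : G ⧸ Γ) = q.2} = (fun q : G × G => q.1⁻¹ * q.2) ⁻¹' (Γ : Set G) := by
    ext q
    exact QuotientGroup.eq
  rw [this]
  exact hΓ.preimage (by fun_prop)

/-- A discrete torsion-free subgroup acts freely on the cosets of a compact subgroup, because its
point stabilizers are finite. -/
lemma eq_one_of_smul_eq [T2Space G] {K Γ : Subgroup G} (hK : IsCompact (K : Set G))
    [DiscreteTopology Γ]
    [IsMulTorsionFree Γ] (γ : Γ) (x : G ⧸ K) (h : γ • x = x) : γ = 1 := by
  obtain ⟨g, rfl⟩ := QuotientGroup.mk_surjective x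
  have hC : IsCompact ((fun k => g * k * g⁻¹) '' (K : Set G)) := hK.image (by fun_prop)
  have hclosed : IsClosed (Γ : Set G) := Subgroup.isClosed_of_discrete
  have hfin : (((fun k => g * k * g⁻¹) '' (K : Set G)) ∩ Γ).Finite := by
    refine (hC.inter_right hclosed).finite ?_
    exact IsDiscrete.mono (isDiscrete_iff_discreteTopology.2 ‹_›) Set.inter_subset_right
  have hmem : g⁻¹ * γ * g ∈ K := by
    have : ((γ : G) * g : G ⧸ K) = (g : G ⧸ K) := h
    have := QuotientGroup.eq.1 this.symm
    rwa [← mul_assoc] at this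
  have hpow : ∀ i : ℕ, ((γ ^ i : Γ) : G) ∈ ((fun k => g * k * g⁻¹) '' (K : Set G)) ∩ Γ := by
    intro i
    refine ⟨⟨(g⁻¹ * γ * g) ^ i, K.pow_mem hmem i, ?_⟩, (γ ^ i).2⟩
    have := conj_pow (i := i) (a := g⁻¹) (b := (γ : G))
    rw [inv_inv] at this
    simp only [this, Subgroup.coe_pow]
    group
  by_contra hne
  have hinj : Function.Injective fun i : ℕ => γ ^ i :=
    injective_pow_iff_not_isOfFinOrder.2 (not_isOfFinOrder_of_isMulTorsionFree hne)
  exact Set.infinite_of_injective_forall_mem (Subtype.val_injective.comp hinj) hpow hfin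

variable [LocallyCompactSpace G] [T2Space G] [SecondCountableTopology G]

variable (G) in
/-- A second countable locally compact group is complete for its right uniformity. -/
lemma polishSpace_of_locallyCompact_group : PolishSpace G := by
  let _ : UniformSpace G := IsTopologicalGroup.rightUniformSpace G
  have : IsRightUniformGroup G := ⟨rfl⟩
  have : CompleteSpace G := IsRightUniformGroup.completeSpace_of_weaklyLocallyCompactSpace
  have : (_root_.uniformity G).IsCountablyGenerated := by
    rw [IsRightUniformGroup.uniformity_eq]
    infer_instance
  infer_instance

variable [MeasurableSpace G] [BorelSpace G]

lemma borelSpace_quotient_of_isClosed {Γ : Subgroup G} (hΓ : IsClosed (Γ : Set G)) :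
    BorelSpace (G ⧸ Γ) := by
  have := t2Space_quotient_of_isClosed hΓ
  have := polishSpace_of_locallyCompact_group G
  infer_instance

lemma regular_of_isFiniteMeasure_quotient {Γ : Subgroup G} (hΓ : IsClosed (Γ : Set G))
    (ξ : Measure (G ⧸ Γ)) [IsFiniteMeasure ξ] : ξ.Regular := by
  have := t2Space_quotient_of_isClosed hΓ
  have := borelSpace_quotient_of_isClosed hΓ
  infer_instance

end CosetSpace

/-! ### Measures of orbits of compact open subgroups -/

section OrbitMeasure

/-- If a subgroup `K` acts simply transitively on an orbit, then the orbit is the disjoint union of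
`[K : U]` translates of the orbit of a subgroup `U`. -/
lemma measure_orbit_eq_card_mul {G α : Type*} [Group G] [MulAction G α] [MeasurableSpace α]
    (ξ : Measure α) {U K : Subgroup G} (hUK : U ≤ K) [Finite (K ⧸ U.subgroupOf K)] (x : α)
    (hfree : ∀ k ∈ K, k • x = x → k = 1)
    (hmeas : ∀ g : G, MeasurableSet ((fun u : G => (g * u) • x) '' (U : Set G)))
    (hinv : ∀ g : G, ξ ((fun u : G => (g * u) • x) '' (U : Set G)) =
      ξ ((fun u : G => u • x) '' (U : Set G))) :
    ξ ((fun k : G => k • x) '' (K : Set G)) =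
      Nat.card (K ⧸ U.subgroupOf K) * ξ ((fun u : G => u • x) '' (U : Set G)) := by
  have := Fintype.ofFinite (K ⧸ U.subgroupOf K)
  have hunion : (fun k : G => k • x) '' (K : Set G) =
      ⋃ c : K ⧸ U.subgroupOf K, (fun u : G => ((c.out : G) * u) • x) '' (U : Set G) := by
    ext y
    simp only [Set.mem_image, Set.mem_iUnion, SetLike.mem_coe]
    constructor
    · rintro ⟨k, hk, rfl⟩
      refine ⟨((⟨k, hk⟩ : K) : K ⧸ U.subgroupOf K),
        ((((⟨k, hk⟩ : K) : K ⧸ U.subgroupOf K).out : G))⁻¹ * k, ?_, ?_⟩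
      · have := QuotientGroup.eq.1 (QuotientGroup.out_eq' ((⟨k, hk⟩ : K) : K ⧸ U.subgroupOf K))
        simpa [Subgroup.mem_subgroupOf] using this
      · simp
    · rintro ⟨c, u, hu, rfl⟩
      exact ⟨c.out * u, K.mul_mem c.out.2 (hUK hu), rfl⟩
  have hdisj : Pairwise (Function.onFun Disjoint fun c : K ⧸ U.subgroupOf K =>
      (fun u : G => ((c.out : G) * u) • x) '' (U : Set G)) := by
    intro c d hcd
    refine Set.disjoint_left.2 ?_
    rintro _ ⟨u, hu, rfl⟩ ⟨w, hw, hwu⟩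
    apply hcd
    have h1 : ((c.out : G) * u)⁻¹ * ((d.out : G) * w) = 1 := by
      refine hfree _ (K.mul_mem (K.inv_mem (K.mul_mem c.out.2 (hUK hu)))
        (K.mul_mem d.out.2 (hUK hw))) ?_
      rw [mul_smul, inv_smul_eq_iff]
      exact hwu
    have h2 : (c.out : G)⁻¹ * d.out = u * w⁻¹ := by
      rw [inv_mul_eq_one] at h1
      rw [inv_mul_eq_iff_eq_mul, ← mul_assoc, h1]
      group
    have h3 : (c.out : K)⁻¹ * d.out ∈ U.subgroupOf K := by
      rw [Subgroup.mem_subgroupOf]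
      simpa [h2] using U.mul_mem hu (U.inv_mem hw)
    rw [← QuotientGroup.out_eq' c, ← QuotientGroup.out_eq' d]
    exact QuotientGroup.eq.2 h3
  rw [hunion, measure_iUnion hdisj fun c => hmeas _]
  simp [hinv, tsum_fintype, Nat.card_eq_fintype_card]

end OrbitMeasure

section DoubleCosets

variable {G : Type*} [Group G] {K Γ : Subgroup G}

/-- If `Γ` acts freely on `G ⧸ K`, then `K` acts freely on `G ⧸ Γ`. -/
lemma eq_one_of_smul_coset_eq (hfree : ∀ (γ : Γ) (x : G ⧸ K), γ • x = x → γ = 1)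
    (x : G ⧸ Γ) (k : G) (hk : k ∈ K) (h : k • x = x) : k = 1 := by
  obtain ⟨g, rfl⟩ := QuotientGroup.mk_surjective x
  have hmem : g⁻¹ * k * g ∈ Γ := by
    have h' : ((k * g : G) : G ⧸ Γ) = (g : G ⧸ Γ) := h
    have := QuotientGroup.eq.1 h'.symm
    rwa [← mul_assoc] at this
  have h1 : (⟨g⁻¹ * k * g, hmem⟩ : Γ) • ((g⁻¹ : G) : G ⧸ K) = ((g⁻¹ : G) : G ⧸ K) := by
    change ((g⁻¹ * k * g * g⁻¹ : G) : G ⧸ K) = ((g⁻¹ : G) : G ⧸ K)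
    refine (QuotientGroup.eq.2 ?_).symm
    simpa using hk
  have h2 := congrArg Subtype.val (hfree _ _ h1)
  simpa [mul_assoc, inv_mul_eq_one, eq_comm] using h2

/-- Representatives of the double cosets `K \ G / Γ`, indexed by the `Γ`-orbits on `G ⧸ K`: every
element of `G` can be written uniquely as `k * r ω * γ`. -/
lemma exists_doubleCoset_representatives
    (hfree : ∀ (γ : Γ) (x : G ⧸ K), γ • x = x → γ = 1) :
    ∃ r : MulAction.orbitRel.Quotient Γ (G ⧸ K) → G,
      (∀ g : G, ∃ ω, ∃ k ∈ K, ∃ γ ∈ Γ, g = k * r ω * γ) ∧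
      ∀ ω ω', ∀ k ∈ K, ∀ k' ∈ K, ∀ γ ∈ Γ, ∀ γ' ∈ Γ, k * r ω * γ = k' * r ω' * γ' →
        ω = ω' ∧ γ = γ' := by
  obtain ⟨s, o, c, hc, hos, hcs, hoγ, hcγ⟩ := exists_coordinates_of_free hfree
  choose t ht using fun ω => QuotientGroup.mk_surjective (s ω)
  have hcoe : ∀ (γ : Γ) (k : G), k ∈ K → ∀ ω,
      (((k * (t ω)⁻¹ * γ)⁻¹ : G) : G ⧸ K) = γ⁻¹ • s ω := by
    intro γ k hk ω
    rw [← ht ω]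
    change _ = (((γ : G)⁻¹ * t ω : G) : G ⧸ K)
    refine QuotientGroup.eq.2 ?_
    have : (((k * (t ω)⁻¹ * γ)⁻¹)⁻¹ : G) * ((γ : G)⁻¹ * t ω) = k := by group
    rw [this]
    exact hk
  refine ⟨fun ω => (t ω)⁻¹, ?_, ?_⟩
  · intro g
    have h := hc ((g⁻¹ : G) : G ⧸ K)
    set v : G ⧸ K := ((g⁻¹ : G) : G ⧸ K) with hv
    rw [← ht] at h
    have h1 : (((c v : G) * t (o v) : G) : G ⧸ K) = ((g⁻¹ : G) : G ⧸ K) := h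
    have h2 := QuotientGroup.eq.1 h1
    refine ⟨o v, _, K.inv_mem h2, _, (c v)⁻¹.2, ?_⟩
    rw [Subgroup.coe_inv]
    group
  · intro ω ω' k hk k' hk' γ hγ γ' hγ' h
    have h1 := hcoe ⟨γ, hγ⟩ k hk ω
    have h2 := hcoe ⟨γ', hγ'⟩ k' hk' ω'
    rw [show k * (t ω)⁻¹ * ((⟨γ, hγ⟩ : Γ) : G) = k' * (t ω')⁻¹ * ((⟨γ', hγ'⟩ : Γ) : G) from h, h2]
      at h1
    have h3 := congrArg o h1
    rw [hoγ, hoγ, hos, hos] at h3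
    have h4 := congrArg c h1
    rw [hcγ, hcγ, hcs, hcs, mul_one, mul_one, _root_.inv_inj] at h4
    exact ⟨h3.symm, (congrArg Subtype.val h4).symm⟩

end DoubleCosets

section OrbitsInCosetSpace

variable {G : Type*} [Group G] [TopologicalSpace G] [IsTopologicalGroup G] {K Γ : Subgroup G}

lemma isOpen_image_smul_coset {W : Set G} (hW : IsOpen W) (x : G ⧸ Γ) :
    IsOpen ((fun u : G => u • x) '' W) := by
  obtain ⟨g, rfl⟩ := QuotientGroup.mk_surjective x
  have : (fun u : G => u • (g : G ⧸ Γ)) '' W = (QuotientGroup.mk : G → G ⧸ Γ) '' ((· * g) '' W) := by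
    rw [Set.image_image]
    rfl
  rw [this]
  exact QuotientGroup.isOpenMap_coe _ (isOpenMap_mul_right g _ hW)

variable [LocallyCompactSpace G] [T2Space G] [SecondCountableTopology G] [MeasurableSpace G]
  [BorelSpace G]

/-- In a unimodular group, all orbits of a compact open subgroup acting freely on a coset space
have the same measure: the orbits of `gΓ` and `Γ` decompose into orbits of the subgroups
`K ∩ gKg⁻¹` and `K ∩ g⁻¹Kg`, which have the same index in `K`. -/
lemma measure_orbit_coset_eq (hKo : IsOpen (K : Set G)) (hKc : IsCompact (K : Set G))
    (hΓ : IsClosed (Γ : Set G)) (hfree : ∀ (γ : Γ) (x : G ⧸ K), γ • x = x → γ = 1)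
    (μ : Measure G) [μ.IsHaarMeasure] [μ.IsMulRightInvariant]
    (ξ : Measure (G ⧸ Γ)) [SMulInvariantMeasure G (G ⧸ Γ) ξ] (x y : G ⧸ Γ) :
    ξ ((fun k : G => k • x) '' (K : Set G)) = ξ ((fun k : G => k • y) '' (K : Set G)) := by
  have := borelSpace_quotient_of_isClosed hΓ
  have hK : CompactSpace K := isCompact_iff_compactSpace.1 hKc
  suffices h : ∀ x : G ⧸ Γ, ξ ((fun k : G => k • x) '' (K : Set G)) =
      ξ ((fun k : G => k • ((1 : G) : G ⧸ Γ)) '' (K : Set G)) by rw [h x, h y]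
  intro x
  obtain ⟨g, rfl⟩ := QuotientGroup.mk_surjective x
  let U : Subgroup G := K ⊓ K.comap (MulAut.conj g⁻¹).toMonoidHom
  let U' : Subgroup G := K ⊓ K.comap (MulAut.conj g).toMonoidHom
  have hUmem : ∀ u, u ∈ U ↔ u ∈ K ∧ g⁻¹ * u * g ∈ K := fun u => by simp [U]
  have hU'mem : ∀ u, u ∈ U' ↔ u ∈ K ∧ g * u * g⁻¹ ∈ K := fun u => by simp [U']
  have hUo : IsOpen (U : Set G) := by
    have : (U : Set G) = (K : Set G) ∩ (fun u => g⁻¹ * u * g) ⁻¹' K := Set.ext hUmem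
    rw [this]
    exact hKo.inter (hKo.preimage (by fun_prop))
  have hU'o : IsOpen (U' : Set G) := by
    have : (U' : Set G) = (K : Set G) ∩ (fun u => g * u * g⁻¹) ⁻¹' K := Set.ext hU'mem
    rw [this]
    exact hKo.inter (hKo.preimage (by fun_prop))
  have hfin : ∀ V : Subgroup G, IsOpen (V : Set G) → Finite (K ⧸ V.subgroupOf K) := by
    intro V hV
    exact Subgroup.quotient_finite_of_isOpen _ (hV.preimage continuous_subtype_val)
  have hUfin := hfin U hUo
  have hU'fin := hfin U' hU'o
  have hξ : ∀ V : Subgroup G, IsOpen (V : Set G) → V ≤ K → ∀ z : G ⧸ Γ,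
      ξ ((fun k : G => k • z) '' (K : Set G)) =
        Nat.card (K ⧸ V.subgroupOf K) * ξ ((fun u : G => u • z) '' (V : Set G)) := by
    intro V hV hVK z
    have := hfin V hV
    have htrans : ∀ h : G, (fun u : G => (h * u) • z) '' (V : Set G) =
        (fun w : G ⧸ Γ => h⁻¹ • w) ⁻¹' ((fun u : G => u • z) '' (V : Set G)) := by
      intro h
      ext w
      simp only [Set.mem_image, Set.mem_preimage, mul_smul, eq_inv_smul_iff]
    have hVm : MeasurableSet ((fun u : G => u • z) '' (V : Set G)) :=
      (isOpen_image_smul_coset hV z).measurableSet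
    refine measure_orbit_eq_card_mul ξ hVK z (eq_one_of_smul_coset_eq hfree z) ?_ ?_
    · intro h
      rw [htrans]
      exact (measurable_const_smul h⁻¹) hVm
    · intro h
      rw [htrans]
      exact SMulInvariantMeasure.measure_preimage_smul h⁻¹ hVm
  have hμ : ∀ V : Subgroup G, IsOpen (V : Set G) → V ≤ K →
      μ K = Nat.card (K ⧸ V.subgroupOf K) * μ V := by
    intro V hV hVK
    have := hfin V hV
    have h := measure_orbit_eq_card_mul μ hVK (1 : G) (fun k _ hk => by simpa using hk)
      (fun h => ((isOpenMap_mul_left h _ hV).measurableSet).congr (by simp))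
      (fun h => by
        have : (fun u : G => (h * u) • (1 : G)) '' (V : Set G) = (fun u => h⁻¹ * u) ⁻¹' V := by
          rw [← Set.image_mul_left]
          simp
        rw [this, measure_preimage_mul]
        simp)
    simpa using h
  have hμU : μ U = μ U' := by
    have : (U' : Set G) = (fun u => g * u) ⁻¹' ((fun u => u * g⁻¹) ⁻¹' (U : Set G)) := by
      ext u
      simp only [Set.mem_preimage, SetLike.mem_coe, hUmem, hU'mem]
      rw [and_comm]
      simp [mul_assoc]
    rw [this, measure_preimage_mul, measure_preimage_mul_right]
  have hμU0 : μ U ≠ 0 := (hUo.measure_pos μ ⟨1, U.one_mem⟩).ne'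
  have hμUtop : μ U ≠ ⊤ :=
    (lt_of_le_of_lt (measure_mono fun u hu => ((hUmem u).1 hu).1) hKc.measure_lt_top).ne
  have hcard : (Nat.card (K ⧸ U.subgroupOf K) : ℝ≥0∞) = Nat.card (K ⧸ U'.subgroupOf K) := by
    have h1 := hμ U hUo inf_le_left
    have h2 := hμ U' hU'o inf_le_left
    rw [h1, ← hμU] at h2
    exact (ENNReal.mul_left_inj hμU0 hμUtop).1 h2
  have hξU : ξ ((fun u : G => u • (g : G ⧸ Γ)) '' (U : Set G)) =
      ξ ((fun u : G => u • ((1 : G) : G ⧸ Γ)) '' (U' : Set G)) := by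
    have himg : (fun u : G => u • (g : G ⧸ Γ)) '' (U : Set G) =
        (fun w : G ⧸ Γ => g⁻¹ • w) ⁻¹' ((fun u : G => u • ((1 : G) : G ⧸ Γ)) '' (U' : Set G)) := by
      ext w
      simp only [Set.mem_image, Set.mem_preimage, SetLike.mem_coe, hUmem, hU'mem]
      constructor
      · rintro ⟨u, ⟨hu1, hu2⟩, rfl⟩
        refine ⟨g⁻¹ * u * g, ⟨hu2, by simpa [mul_assoc] using hu1⟩, ?_⟩
        change ((g⁻¹ * u * g * 1 : G) : G ⧸ Γ) = ((g⁻¹ * (u * g) : G) : G ⧸ Γ)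
        simp [mul_assoc]
      · rintro ⟨u, ⟨hu1, hu2⟩, hw⟩
        refine ⟨g * u * g⁻¹, ⟨hu2, by simpa [mul_assoc] using hu1⟩, ?_⟩
        rw [eq_inv_smul_iff] at hw
        rw [← hw]
        change ((g * u * g⁻¹ * g : G) : G ⧸ Γ) = ((g * (u * 1) : G) : G ⧸ Γ)
        simp [mul_assoc]
    rw [himg]
    exact SMulInvariantMeasure.measure_preimage_smul g⁻¹
      (isOpen_image_smul_coset hU'o _).measurableSet
  rw [hξ U hUo inf_le_left, hξ U' hU'o inf_le_left, hcard, hξU]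

end OrbitsInCosetSpace

/-! ### Covolumes and double cosets -/

section Covolume

variable {G : Type*} [Group G] {K Γ : Subgroup G}

lemma automorphize_coe {M : Type*} [AddCommMonoid M] [TopologicalSpace M] (f : G → M) (g : G) :
    QuotientGroup.automorphize f (g : G ⧸ Γ) = ∑' γ : Γ.op, f (g * (γ : Gᵐᵒᵖ).unop) :=
  rfl

variable [TopologicalSpace G] [IsTopologicalGroup G]

variable [MeasurableSpace G] [BorelSpace G]

lemma measurable_automorphize [Countable Γ] {f : G → ℝ} (hf : Continuous f) :
    Measurable (QuotientGroup.automorphize f : G ⧸ Γ → ℝ) := by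
  have hcount : Countable Γ.op := Γ.equivOp.symm.injective.countable
  refine measurable_from_quotient.2 ?_
  exact Measurable.tsum fun γ : Γ.op => (by fun_prop : Continuous fun g : G =>
    f (g * (γ : Gᵐᵒᵖ).unop)).measurable

/-- Testing the compatibility of measures against the indicator function of `K`. -/
lemma measure_orbit_one_of_compatible [T2Space G] (hKo : IsOpen (K : Set G))
    (hKc : IsCompact (K : Set G)) (hfree : ∀ (γ : Γ) (x : G ⧸ K), γ • x = x → γ = 1)
    (μ : Measure G) [IsFiniteMeasureOnCompacts μ] (ξ : Measure (G ⧸ Γ))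
    (hξ : IsCompatibleCosetHaar μ Γ ξ) :
    ξ ((fun k : G => k • ((1 : G) : G ⧸ Γ)) '' (K : Set G)) = μ K := by
  classical
  obtain ⟨⟨hreg, -, -⟩, hcomp⟩ := hξ
  set O : Set (G ⧸ Γ) := (fun k : G => k • ((1 : G) : G ⧸ Γ)) '' (K : Set G) with hO
  have hOmem : ∀ g : G, (g : G ⧸ Γ) ∈ O ↔ ∃ γ ∈ Γ, g * γ ∈ K := by
    intro g
    constructor
    · rintro ⟨k, hk, hkg⟩
      have h1 : ((k * 1 : G) : G ⧸ Γ) = g := hkg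
      refine ⟨g⁻¹ * k, ?_, by simpa using hk⟩
      have := Γ.inv_mem (QuotientGroup.eq.1 h1)
      simpa using this
    · rintro ⟨γ, hγ, hk⟩
      refine ⟨g * γ, hk, ?_⟩
      change ((g * γ * 1 : G) : G ⧸ Γ) = g
      refine (QuotientGroup.eq.2 ?_).symm
      simpa using hγ
  let f : G → ℝ := (K : Set G).indicator 1
  have hf : Continuous f :=
    (IsClopen.continuous_indicator ⟨Subgroup.isClosed_of_isOpen K hKo, hKo⟩ continuous_one)
  have hfc : HasCompactSupport f :=
    HasCompactSupport.intro hKc fun x hx => Set.indicator_of_notMem hx _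
  have hauto : (QuotientGroup.automorphize f : G ⧸ Γ → ℝ) = O.indicator 1 := by
    ext x
    obtain ⟨g, rfl⟩ := QuotientGroup.mk_surjective x
    rw [automorphize_coe]
    by_cases h : (g : G ⧸ Γ) ∈ O
    · rw [Set.indicator_of_mem h]
      obtain ⟨γ, hγ, hk⟩ := (hOmem g).1 h
      rw [tsum_eq_single (⟨MulOpposite.op γ, hγ⟩ : Γ.op)]
      · exact Set.indicator_of_mem hk _
      · rintro ⟨δ, hδ⟩ hne
        refine Set.indicator_of_notMem (fun hk' => hne ?_) _
        have h1 : (γ⁻¹ * δ.unop : G) ∈ Γ := Γ.mul_mem (Γ.inv_mem hγ) hδ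
        have h2 := hfree (⟨_, h1⟩ : Γ) (((g * δ.unop)⁻¹ : G) : G ⧸ K) (by
          change ((γ⁻¹ * δ.unop * (g * δ.unop)⁻¹ : G) : G ⧸ K) = _
          refine QuotientGroup.eq.2 ?_
          have := K.mul_mem hk (K.inv_mem hk')
          convert this using 1
          group)
        have h3 := congrArg Subtype.val h2
        rw [Subgroup.coe_one, inv_mul_eq_one] at h3
        apply Subtype.ext
        exact MulOpposite.unop_injective h3.symm
    · rw [Set.indicator_of_notMem h]
      have : ∀ γ : Γ.op, f (g * (γ : Gᵐᵒᵖ).unop) = 0 := fun γ =>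
        Set.indicator_of_notMem (fun hk => h ((hOmem g).2 ⟨_, γ.2, hk⟩)) _
      simp [this]
  have hOm : MeasurableSet O := by
    have : MeasurableSet ((QuotientGroup.mk : G → G ⧸ Γ) ⁻¹' O) :=
      ((isOpen_image_smul_coset hKo _).preimage QuotientGroup.continuous_mk).measurableSet
    exact this
  have hOc : IsCompact O := by
    have : O = (QuotientGroup.mk : G → G ⧸ Γ) '' K := by
      rw [hO]
      congr 1
      ext k
      change ((k * 1 : G) : G ⧸ Γ) = k
      rw [mul_one]
    rw [this]
    exact hKc.image QuotientGroup.continuous_mk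
  have h := hcomp f hf hfc
  rw [hauto, integral_indicator_one hKo.measurableSet, integral_indicator_one hOm] at h
  exact ((ENNReal.toReal_eq_toReal_iff' hKc.measure_lt_top.ne hOc.measure_lt_top.ne).1 h).symm

variable [LocallyCompactSpace G] [T2Space G] [SecondCountableTopology G]

/-- The total mass of an invariant measure on `G ⧸ Γ` is the number of double cosets in
`K \ G / Γ` times the mass of a `K`-orbit. -/
lemma measure_univ_eq_card_orbits_mul (hKo : IsOpen (K : Set G)) (hKc : IsCompact (K : Set G))
    (hΓ : IsClosed (Γ : Set G)) (hfree : ∀ (γ : Γ) (x : G ⧸ K), γ • x = x → γ = 1)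
    (μ : Measure G) [μ.IsHaarMeasure] [μ.IsMulRightInvariant]
    (ξ : Measure (G ⧸ Γ)) [SMulInvariantMeasure G (G ⧸ Γ) ξ] :
    ξ Set.univ = ENat.card (MulAction.orbitRel.Quotient Γ (G ⧸ K)) *
      ξ ((fun k : G => k • ((1 : G) : G ⧸ Γ)) '' (K : Set G)) := by
  have := borelSpace_quotient_of_isClosed hΓ
  have : DiscreteTopology (G ⧸ K) := QuotientGroup.discreteTopology hKo
  have : Countable (G ⧸ K) := TopologicalSpace.separableSpace_iff_countable.1 inferInstance
  have : Countable (MulAction.orbitRel.Quotient Γ (G ⧸ K)) := Quotient.countable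
  obtain ⟨r, hr, hr'⟩ := exists_doubleCoset_representatives hfree
  have hcover : (Set.univ : Set (G ⧸ Γ)) =
      ⋃ ω, (fun k : G => k • ((r ω : G) : G ⧸ Γ)) '' (K : Set G) := by
    symm
    rw [Set.eq_univ_iff_forall]
    intro x
    obtain ⟨g, rfl⟩ := QuotientGroup.mk_surjective x
    obtain ⟨ω, k, hk, γ, hγ, rfl⟩ := hr g
    refine Set.mem_iUnion.2 ⟨ω, k, hk, ?_⟩
    refine QuotientGroup.eq.2 ?_
    change (k * r ω)⁻¹ * (k * r ω * γ) ∈ Γ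
    rwa [inv_mul_cancel_left]
  have hdisj : Pairwise (Function.onFun Disjoint fun ω =>
      (fun k : G => k • ((r ω : G) : G ⧸ Γ)) '' (K : Set G)) := by
    intro ω ω' hne
    refine Set.disjoint_left.2 ?_
    rintro _ ⟨k, hk, rfl⟩ ⟨k', hk', h⟩
    have h1 : ((k' * r ω' : G) : G ⧸ Γ) = ((k * r ω : G) : G ⧸ Γ) := h
    have h2 := QuotientGroup.eq.1 h1
    refine hne (hr' ω ω' k hk k' hk' 1 Γ.one_mem _ h2 ?_).1
    group
  rw [hcover, measure_iUnion hdisj fun ω => (isOpen_image_smul_coset hKo _).measurableSet]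
  simp_rw [fun ω => measure_orbit_coset_eq hKo hKc hΓ hfree μ ξ ((r ω : G) : G ⧸ Γ)
    ((1 : G) : G ⧸ Γ)]
  rw [ENNReal.tsum_const]

/-- A lattice acting freely on `G ⧸ K` has finitely many orbits there: they index disjoint sets of
equal positive measure in `G ⧸ Γ`. -/
lemma finite_orbits_of_isGroupLattice (hKo : IsOpen (K : Set G)) (hKc : IsCompact (K : Set G))
    (hΓ : IsClosed (Γ : Set G)) (hfree : ∀ (γ : Γ) (x : G ⧸ K), γ • x = x → γ = 1)
    (μ : Measure G) [μ.IsHaarMeasure] [μ.IsMulRightInvariant] (hlat : IsGroupLattice Γ) :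
    Finite (MulAction.orbitRel.Quotient Γ (G ⧸ K)) := by
  obtain ⟨-, ξ, ⟨-, hinv, hne⟩, hfin⟩ := hlat
  have h := measure_univ_eq_card_orbits_mul hKo hKc hΓ hfree μ ξ
  -- with infinitely many orbits the total mass would be `0` or `∞`
  by_contra hinf
  rw [not_finite_iff_infinite] at hinf
  rw [ENat.card_eq_top_of_infinite] at h
  have hpos : ξ ((fun k : G => k • ((1 : G) : G ⧸ Γ)) '' (K : Set G)) ≠ 0 := by
    intro h0
    rw [h0, mul_zero] at h
    exact hne (Measure.measure_univ_eq_zero.1 h)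
  rw [ENat.toENNReal_top, ENNReal.top_mul hpos] at h
  exact measure_ne_top ξ _ h

/-- Existence of a compatible measure on `G ⧸ Γ`: push forward the restriction of `μ` to the union
of the cosets `K r`, where `r` runs over representatives of the double cosets; this union is a
fundamental domain for `Γ`. -/
lemma exists_isCompatibleCosetHaar [Countable Γ] (hKo : IsOpen (K : Set G))
    (hKc : IsCompact (K : Set G)) (hΓ : IsClosed (Γ : Set G))
    (hfree : ∀ (γ : Γ) (x : G ⧸ K), γ • x = x → γ = 1)
    (μ : Measure G) [μ.IsHaarMeasure] [μ.IsMulRightInvariant]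
    [Finite (MulAction.orbitRel.Quotient Γ (G ⧸ K))] :
    ∃ ξ : Measure (G ⧸ Γ), IsCompatibleCosetHaar μ Γ ξ := by
  have := t2Space_quotient_of_isClosed hΓ
  have := borelSpace_quotient_of_isClosed hΓ
  have := polishSpace_of_locallyCompact_group G
  have hcount : Countable Γ.op := Γ.equivOp.symm.injective.countable
  obtain ⟨r, hr, hr'⟩ := exists_doubleCoset_representatives hfree
  let D : Set G := ⋃ ω, (fun k => k * r ω) '' (K : Set G)
  have hDo : IsOpen D := isOpen_iUnion fun ω => isOpenMap_mul_right _ _ hKo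
  have hDc : IsCompact D := isCompact_iUnion fun ω => hKc.image (by fun_prop)
  have hD : IsFundamentalDomain Γ.op D μ := by
    refine IsFundamentalDomain.mk' hDo.measurableSet.nullMeasurableSet fun g => ?_
    obtain ⟨ω, k, hk, γ, hγ, rfl⟩ := hr g
    refine ⟨⟨MulOpposite.op γ⁻¹, Γ.inv_mem hγ⟩, ?_, ?_⟩
    · refine Set.mem_iUnion.2 ⟨ω, k, hk, ?_⟩
      change k * r ω = k * r ω * γ * γ⁻¹
      group
    · rintro ⟨δ, hδ⟩ hmem
      obtain ⟨ω', k', hk', h⟩ := Set.mem_iUnion.1 hmem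
      have h1 : k' * r ω' = k * r ω * γ * δ.unop := h
      have h2 := (hr' ω ω' k hk k' hk' γ hγ δ.unop⁻¹ (Γ.inv_mem hδ) (by
        rw [h1]
        group)).2
      apply Subtype.ext
      apply MulOpposite.unop_injective
      rw [MulOpposite.unop_op, h2, inv_inv]
  let ξ : Measure (G ⧸ Γ) := Measure.map (QuotientGroup.mk : G → G ⧸ Γ) (μ.restrict D)
  have hmk : Measurable (QuotientGroup.mk : G → G ⧸ Γ) := QuotientGroup.continuous_mk.measurable
  have hq : QuotientMeasureEqMeasurePreimage μ ξ :=
    hD.quotientMeasureEqMeasurePreimage_quotientMeasure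
  have hfun : HasFundamentalDomain Γ.op G μ := ⟨D, hD⟩
  have hinv : SMulInvariantMeasure G (G ⧸ Γ) ξ :=
    QuotientMeasureEqMeasurePreimage.smulInvariantMeasure_quotient μ
  have hξuniv : ξ Set.univ = μ D := by
    rw [Measure.map_apply hmk MeasurableSet.univ, Set.preimage_univ, Measure.restrict_apply_univ]
  have hξfin : IsFiniteMeasure ξ := ⟨by rw [hξuniv]; exact hDc.measure_lt_top⟩
  have hDne : D.Nonempty := by
    obtain ⟨ω, k, hk, -⟩ := hr 1
    exact ⟨k * r ω, Set.mem_iUnion.2 ⟨ω, k, hk, rfl⟩⟩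
  refine ⟨ξ, ⟨regular_of_isFiniteMeasure_quotient hΓ ξ, hinv, fun h0 => ?_⟩, fun f hf hfc => ?_⟩
  · rw [h0] at hξuniv
    exact (hDo.measure_pos μ hDne).ne hξuniv
  · exact QuotientGroup.integral_eq_integral_automorphize hD (hf.integrable_of_hasCompactSupport hfc)
      (measurable_automorphize hf).aestronglyMeasurable

/-- The covolume of a lattice acting freely on `G ⧸ K`, for a compact open subgroup `K` of a
unimodular group, is the number of its orbits times the volume of `K`. -/
theorem hasCovolume_card_orbits_mul [Countable Γ] (hKo : IsOpen (K : Set G))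
    (hKc : IsCompact (K : Set G)) (hΓ : IsClosed (Γ : Set G))
    (hfree : ∀ (γ : Γ) (x : G ⧸ K), γ • x = x → γ = 1)
    (μ : Measure G) [μ.IsHaarMeasure] [μ.IsMulRightInvariant]
    [Finite (MulAction.orbitRel.Quotient Γ (G ⧸ K))] :
    HasCovolume μ Γ (Nat.card (MulAction.orbitRel.Quotient Γ (G ⧸ K)) * μ K) := by
  refine ⟨exists_isCompatibleCosetHaar hKo hKc hΓ hfree μ, fun ξ hξ => ?_⟩
  have := hξ.1.invariant
  rw [measure_univ_eq_card_orbits_mul hKo hKc hΓ hfree μ ξ,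
    measure_orbit_one_of_compatible hKo hKc hfree μ ξ hξ, ENat.card_eq_coe_natCard]
  simp

end Covolume

/-! ### The topology of `PGL(2, F)` -/

section Topology

lemma continuous_projGenLinGroup_mk {F : Type*} [Field F] [TopologicalSpace F] :
    Continuous (ProjGenLinGroup.mk : GL (Fin 2) F → PGL(2, F)) :=
  QuotientGroup.continuous_mk (N := Subgroup.center (GL (Fin 2) F))

lemma isOpenMap_projGenLinGroup_mk {F : Type*} [Field F] [TopologicalSpace F]
    [IsTopologicalDivisionRing F] :
    IsOpenMap (ProjGenLinGroup.mk : GL (Fin 2) F → PGL(2, F)) :=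
  QuotientGroup.isOpenMap_coe (N := Subgroup.center (GL (Fin 2) F))

variable {F : Type*} [Field F] [ValuativeRel F] [TopologicalSpace F] [IsNonarchimedeanLocalField F]

variable (F) in
lemma secondCountableTopology_of_isNonarchimedeanLocalField : SecondCountableTopology F := by
  let _ := IsTopologicalAddGroup.rightUniformSpace F
  have := isUniformAddGroup_of_addCommGroup (G := F)
  let _ : (Valued.v (R := F)).RankOne :=
  { hom' := IsRankLeOne.nonempty.some.emb (R := F).comp MonoidWithZeroHom.ValueGroup₀.embedding
    strictMono' := IsRankLeOne.nonempty.some.strictMono.comp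
        MonoidWithZeroHom.ValueGroup₀.embedding_strictMono }
  open scoped Valued in
  have : ProperSpace F := .of_nontriviallyNormedField_of_weaklyLocallyCompactSpace F
  infer_instance

variable (F) in
lemma t2Space_of_isNonarchimedeanLocalField : T2Space F := by
  have h : IsClosed ({0} : Set F) := by
    have : ({0} : Set F) = valuation F ⁻¹' {0} := by ext; simp
    rw [this]
    open scoped WithZeroTopology in
    exact isClosed_singleton.preimage IsValuativeTopology.continuous_valuation
  have := IsTopologicalAddGroup.t1Space F h
  infer_instance

instance : IsTopologicalGroup PGL(2, F) :=
  inferInstanceAs (IsTopologicalGroup (GL (Fin 2) F ⧸ Subgroup.center (GL (Fin 2) F)))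

variable (F) in
lemma t2Space_generalLinearGroup : T2Space (GL (Fin 2) F) := by
  have := t2Space_of_isNonarchimedeanLocalField F
  have : T2Space (Matrix (Fin 2) (Fin 2) F) := inferInstanceAs (T2Space (Fin 2 → Fin 2 → F))
  exact (Units.isEmbedding_embedProduct (M := Matrix (Fin 2) (Fin 2) F)).t2Space

instance : T2Space PGL(2, F) := by
  have := t2Space_generalLinearGroup F
  have : IsClosed ((Subgroup.center (GL (Fin 2) F) : Subgroup (GL (Fin 2) F)) :
      Set (GL (Fin 2) F)) := by
    rw [Subgroup.coe_center, ← Set.centralizer_univ]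
    exact Set.isClosed_centralizer _
  exact inferInstanceAs (T2Space (GL (Fin 2) F ⧸ Subgroup.center (GL (Fin 2) F)))

instance : SecondCountableTopology PGL(2, F) := by
  have := secondCountableTopology_of_isNonarchimedeanLocalField F
  have : SecondCountableTopology (Matrix (Fin 2) (Fin 2) F) :=
    inferInstanceAs (SecondCountableTopology (Fin 2 → Fin 2 → F))
  have : SecondCountableTopology (Matrix (Fin 2) (Fin 2) F)ᵐᵒᵖ :=
    MulOpposite.opHomeomorph.symm.secondCountableTopology
  have : SecondCountableTopology (GL (Fin 2) F) :=
    (Units.isEmbedding_embedProduct (M := Matrix (Fin 2) (Fin 2) F)).secondCountableTopology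
  exact inferInstanceAs
    (SecondCountableTopology (GL (Fin 2) F ⧸ Subgroup.center (GL (Fin 2) F)))

variable (F) in
lemma isCompact_integralPGL : IsCompact (integralPGL F : Set PGL(2, F)) := by
  have h1 : CompactSpace (Matrix (Fin 2) (Fin 2) (Valuation.integer (valuation F))) :=
    inferInstanceAs (CompactSpace (Fin 2 → Fin 2 → Valuation.integer (valuation F)))
  have := t2Space_of_isNonarchimedeanLocalField F
  have : T1Space (Matrix (Fin 2) (Fin 2) (Valuation.integer (valuation F))) :=
    inferInstanceAs (T1Space (Fin 2 → Fin 2 → Valuation.integer (valuation F)))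
  have h2 : CompactSpace (GL (Fin 2) (Valuation.integer (valuation F))) := inferInstance
  rw [integralPGL, MonoidHom.coe_range]
  refine isCompact_range ?_
  rw [MonoidHom.coe_comp]
  exact continuous_projGenLinGroup_mk.comp
    (Continuous.generalLinearGroup_map continuous_subtype_val)

variable (F) in
lemma isOpen_integralPGL : IsOpen (integralPGL F : Set PGL(2, F)) := by
  let S : Set (GL (Fin 2) F) := {g | ∀ i j, valuation F (g i j) ≤ 1} ∩
    {g | valuation F g.1.det = 1}
  have hball : IsOpen {x : F | valuation F x ≤ 1} := by
    open scoped WithZeroTopology in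
    have h : IsOpen (Set.Iic (1 : ValueGroupWithZero F)) :=
      WithZeroTopology.isOpen_iff.2 (Or.inr ⟨1, one_ne_zero, fun _ h => (Set.mem_Iio.1 h).le⟩)
    exact h.preimage IsValuativeTopology.continuous_valuation
  have hsphere : IsOpen {x : F | valuation F x = 1} := by
    open scoped WithZeroTopology in
    have h : IsOpen ({1} : Set (ValueGroupWithZero F)) :=
      WithZeroTopology.isOpen_iff.2 (Or.inl zero_ne_one)
    exact h.preimage IsValuativeTopology.continuous_valuation
  have hS : IsOpen S := by
    refine IsOpen.inter ?_ ?_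
    · simp only [Set.ofPred_forall]
      refine isOpen_iInter_of_finite fun i => isOpen_iInter_of_finite fun j => ?_
      exact hball.preimage (f := fun g : GL (Fin 2) F => g i j)
        ((Units.continuous_val (M := Matrix (Fin 2) (Fin 2) F)).matrix_elem i j)
    · exact hsphere.preimage (f := fun g : GL (Fin 2) F => g.1.det)
        (Units.continuous_val (M := Matrix (Fin 2) (Fin 2) F)).matrix_det
  refine Subgroup.isOpen_of_mem_nhds _ (g := 1) ?_
  refine Filter.mem_of_superset ((isOpenMap_projGenLinGroup_mk S hS).mem_nhds
    ⟨1, ⟨?_, by simp⟩, map_one _⟩) ?_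
  · simp [Fin.forall_fin_two]
  · rintro _ ⟨g, ⟨hg1, hg2⟩, rfl⟩
    exact (mk_mem_integralPGL_iff g).2 ⟨1, by simpa using hg1, by simpa using hg2⟩

instance : LocallyCompactSpace PGL(2, F) :=
  (isCompact_integralPGL F).locallyCompactSpace_of_mem_nhds_of_group
    ((isOpen_integralPGL F).mem_nhds (integralPGL F).one_mem)

end Topology

/-! ### Unimodularity of `PGL(2, F)` -/

section Unimodular

open ProjGenLinGroup

/-- A homomorphism from `PGL(2, F)` to the nonnegative reals is trivial, because `PGL(2, F)` is
generated by elements conjugate to their inverses: transvections and diagonal matrices. -/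
lemma monoidHom_PGL_eq_one {F : Type*} [Field F] (Δ : PGL(2, F) →* NNReal) (x : PGL(2, F)) :
    Δ x = 1 := by
  -- the hypothesis says that `h` conjugates `g` to its inverse modulo scalars
  have hconj : ∀ g h : GL (Fin 2) F, mk (g * h * g) = mk h → Δ (mk g) = 1 := by
    intro g h hgh
    have h1 : Δ (mk h) * Δ (mk h)⁻¹ = 1 := by rw [← map_mul, mul_inv_cancel, map_one]
    have h2 : Δ (mk g) * Δ (mk g) * Δ (mk h) = Δ (mk h) := by
      rw [mul_right_comm, ← map_mul, ← map_mul, ← map_mul, ← map_mul, hgh]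
    have h3 : Δ (mk g) ^ 2 = 1 := by
      rw [sq, ← mul_one (_ * _), ← h1, ← mul_assoc, h2]
    exact (pow_eq_one_iff_of_nonneg zero_le two_ne_zero).1 h3
  have hmul : ∀ (A B : Matrix (Fin 2) (Fin 2) F) (hA : A.det ≠ 0) (hB : B.det ≠ 0)
      (h : (A * B).det ≠ 0), mk (GeneralLinearGroup.mkOfDetNeZero (A * B) h) =
        mk (GeneralLinearGroup.mkOfDetNeZero A hA) * mk (GeneralLinearGroup.mkOfDetNeZero B hB) := by
    intro A B hA hB h
    rw [← map_mul]
    congr 1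
    ext
    rfl
  have key : ∀ M : Matrix (Fin 2) (Fin 2) F, M.det ≠ 0 → ∀ h : M.det ≠ 0,
      Δ (mk (GeneralLinearGroup.mkOfDetNeZero M h)) = 1 := by
    intro M hM
    refine Matrix.diagonal_transvection_induction_of_det_ne_zero
      (fun M => ∀ h : M.det ≠ 0, Δ (mk (GeneralLinearGroup.mkOfDetNeZero M h)) = 1) M hM
      ?_ ?_ ?_
    · intro D _ h
      have hD : D 0 * D 1 ≠ 0 := by simpa [det_diagonal, Fin.prod_univ_two] using h
      refine hconj _ (GeneralLinearGroup.mkOfDetNeZero !![0, 1; 1, 0] (by simp)) ?_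
      refine (mk_eq_mk_iff.2 ⟨Units.mk0 _ hD, ?_⟩).symm
      ext i j
      fin_cases i <;> fin_cases j <;>
        simp [GeneralLinearGroup.mkOfDetNeZero, Matrix.mul_apply, Fin.sum_univ_two,
          Matrix.scalar_apply, mul_comm]
    · intro t h
      refine hconj _ (GeneralLinearGroup.mkOfDetNeZero !![1, 0; 0, -1] (by simp)) ?_
      congr 1
      ext i j
      obtain ⟨a, b, hab, c⟩ := t
      fin_cases a <;> fin_cases b <;> fin_cases i <;> fin_cases j <;>
        simp [GeneralLinearGroup.mkOfDetNeZero, transvection, Matrix.mul_apply,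
          Fin.sum_univ_two, Matrix.single] at hab ⊢
    · intro A B hA hB h1 h2 h
      rw [hmul A B hA hB, map_mul, h1, h2, one_mul]
  obtain ⟨g, rfl⟩ := mk_surjective x
  have hg : g.1.det ≠ 0 := g.det.ne_zero
  rw [← key g.1 hg hg]
  congr 2
  ext
  rfl

end Unimodular

/-! ### The covolume of free lattices -/

/-- Haar measures on `PGL(2, F)` are two-sided invariant. -/
lemma isMulRightInvariant_PGL {F : Type*} [Field F] [ValuativeRel F] [TopologicalSpace F]
    [IsNonarchimedeanLocalField F] [MeasurableSpace PGL(2, F)] [BorelSpace PGL(2, F)]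
    (μ : Measure PGL(2, F)) [μ.IsHaarMeasure] : μ.IsMulRightInvariant := by
  have := polishSpace_of_locallyCompact_group PGL(2, F)
  refine ⟨fun g => ?_⟩
  have h : Measure.modularCharacterFun g = 1 :=
    monoidHom_PGL_eq_one (Measure.modularCharacter (G := PGL(2, F))) g
  rw [Measure.map_right_mul_eq_modularCharacterFun_smul μ g, h, one_smul]

/-- The number of `Γ`-orbits of vertices of the Bruhat–Tits tree, in terms of the rank of `Γ`. -/
lemma card_orbits_mul_eq_of_freeLattice {F : Type*} [Field F] [ValuativeRel F] [TopologicalSpace F]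
    [IsNonarchimedeanLocalField F] {Γ : Subgroup PGL(2, F)} {n : ℕ} (e : Γ ≃* FreeGroup (Fin n))
    (hfree : ∀ (γ : Γ) (x : PGL(2, F) ⧸ integralPGL F), γ • x = x → γ = 1)
    [Finite (MulAction.orbitRel.Quotient Γ (PGL(2, F) ⧸ integralPGL F))] :
    Nat.card (MulAction.orbitRel.Quotient Γ (PGL(2, F) ⧸ integralPGL F)) * (residueCard F + 1) + 2 =
      2 * (Nat.card (MulAction.orbitRel.Quotient Γ (PGL(2, F) ⧸ integralPGL F)) + n) := by
  obtain ⟨ϖ, h0, h1, h2, h3⟩ := exists_uniformizer F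
  have hϖ : IsUniformizer (Units.mk0 ϖ h0) := ⟨h1, h2, h3⟩
  exact card_orbits_mul_eq_of_free_action_on_tree e hfree (bruhatTitsTree (Units.mk0 ϖ h0))
    (fun γ v w h => bruhatTitsTree_adj_smul _ (γ : PGL(2, F)) v w h)
    (card_neighborSet_bruhatTitsTree hϖ)
    (SimpleGraph.preconnected_of_parent (bruhatTitsTree_adj_iff hϖ) (exists_common_ancestor hϖ))
    (SimpleGraph.isCohomologicallyAcyclic_of_parent (bruhatTitsTree_adj_iff hϖ)
      (iterate_ballParent_injective hϖ) (exists_common_ancestor hϖ))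

theorem lemma11p3 {F : Type*} [Field F] [ValuativeRel F] [TopologicalSpace F]
    [IsNonarchimedeanLocalField F]
    [MeasurableSpace PGL(2, F)] [BorelSpace PGL(2, F)]
    (Γ : Subgroup PGL(2, F)) (hΓ : IsGroupLattice Γ)
    (n : ℕ) (hfree : Nonempty (Γ ≃* FreeGroup (Fin n)))
    (μ : Measure PGL(2, F)) [μ.IsHaarMeasure] :
    (μ (integralPGL F : Set PGL(2, F)) = 1 →
      HasCovolume μ Γ
        (ENNReal.ofReal (2 * ((n : ℝ) - 1) / ((residueCard F : ℝ) - 1)))) ∧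
    (μ (integralPGL F : Set PGL(2, F)) = (residueCard F : ℝ≥0∞) + 1 →
      HasCovolume μ Γ
        (ENNReal.ofReal
          (2 * ((n : ℝ) - 1) * ((residueCard F : ℝ) + 1) / ((residueCard F : ℝ) - 1)))) ∧
    (μ (integralPGL F : Set PGL(2, F)) = ENNReal.ofReal (((residueCard F : ℝ) - 1) / 2) →
      HasCovolume μ Γ (ENNReal.ofReal ((n : ℝ) - 1))) := by
  obtain ⟨e⟩ := hfree
  have := hΓ.1
  have : IsMulTorsionFree Γ := Function.Injective.isMulTorsionFree e.toMonoidHom e.injective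
  have : Countable Γ := e.injective.countable
  have hcl : IsClosed (Γ : Set PGL(2, F)) := Subgroup.isClosed_of_discrete
  have hKc := isCompact_integralPGL F
  have hKo := isOpen_integralPGL F
  have hfix := fun (γ : Γ) (x : PGL(2, F) ⧸ integralPGL F) (h : γ • x = x) =>
    eq_one_of_smul_eq hKc γ x h
  have := isMulRightInvariant_PGL μ
  have := finite_orbits_of_isGroupLattice hKo hKc hcl hfix μ hΓ
  have hvol := hasCovolume_card_orbits_mul hKo hKc hcl hfix μ
  have hN := card_orbits_mul_eq_of_freeLattice e hfix
  set N := Nat.card (MulAction.orbitRel.Quotient Γ (PGL(2, F) ⧸ integralPGL F))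
  have hq : (1 : ℝ) < residueCard F := by
    exact_mod_cast Finite.one_lt_card (α := IsLocalRing.ResidueField (valuation F).integer)
  have hN' : (N : ℝ) * (residueCard F - 1) = 2 * (n - 1) := by
    have : (N : ℝ) * (residueCard F + 1) + 2 = 2 * (N + n) := by exact_mod_cast hN
    linarith
  have hN'' : 2 * ((n : ℝ) - 1) / ((residueCard F : ℝ) - 1) = N := by
    rw [← hN', mul_div_assoc, div_self (sub_pos.2 hq).ne', mul_one]
  refine ⟨fun h => ?_, fun h => ?_, fun h => ?_⟩
  · rwa [h, mul_one, ← ENNReal.ofReal_natCast, ← hN''] at hvol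
  · rw [h] at hvol
    convert hvol using 1
    rw [mul_div_right_comm, hN'', ENNReal.ofReal_mul N.cast_nonneg,
      ENNReal.ofReal_add (by positivity) zero_le_one]
    simp
  · rw [h, ← ENNReal.ofReal_natCast, ← ENNReal.ofReal_mul N.cast_nonneg] at hvol
    convert hvol using 2
    linarith
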